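/- Let $m\ge 1$, let $M$ be a smooth $(2m+1)$-dimensional manifold with a smooth pseudo-Riemannian metric $g$ and Levi-Civita connection $\nabla$, put $n=2m+1$, and let $\phi$ be a (smooth, real) conformal Killing–Yano tensor on $M$, i.e. a 2-form for which there are a 3-form $\tau$ and a 1-form $K$ with $$\nabla_X\phi=\tfrac13\,X\lrcorner\,\tau+\tfrac1{n-1}\,X^*\wedge K\qquad\text{for all vector fields }X$$ (so that $\tau=d\phi$ and $K=-d^*\phi$). Suppose that at every point the endomorphism $\phi^\sharp$ of the tangent space given by $g(\phi^\sharp X,Y)=\phi(X,Y)$ has $2m$ distinct non-zero complex eigenvalues and a one-dimensional kernel; from now on $K\subset TM$ denotes this kernel. A normal form frame on an open set $U$ consists of smooth complex vector fields $V_0,V_\mu,V^\mu$ ($\mu=1,\dots,m$) on $U$, with dual coframe $e^0,\theta^\mu,\theta_\mu$, such that for some functions $\lambda_\mu$ $$g=e^0\otimes e^0+\sum_\mu(\theta^\mu\otimes\theta_\mu+\theta_\mu\otimes\theta^\mu),\qquad \phi=\sum_\mu\lambda_\mu\,\theta^\mu\wedge\theta_\mu ;$$ thus $V_0$ spans the complexification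 of $K$. A normal form basis at a point is defined in the same way. Suppose that at every point $\tau=d\phi$ satisfies, in normal form bases, for all $\mu,\nu,\kappa$, $$\tau(V_\kappa,V_\mu,V_\nu)=\tau(V^\kappa,V^\mu,V^\nu)=0,\qquad \tau(V_\kappa,V_\mu,V^\nu)=\tau(V^\kappa,V^\mu,V_\nu)=0\ \ (\nu\ne\kappa,\mu),$$ $$\tau(V_\mu,V_\nu,V_0)=\tau(V^\mu,V^\nu,V_0)=\tau(V_\mu,V^\nu,V_0)=0\ \ (\mu\neq\nu).$$ (This holds in particular if $\theta^\mu\wedge\tau(V^\mu,\cdot,\cdot)=0=\theta_\mu\wedge\tau(V_\mu,\cdot,\cdot)$ for each $\mu$, and if $\phi$ is closed.) Then every point of $M$ has a neighbourhood with a normal form frame, and for every normal form frame on an open set $U$ the following holds. The $2^m$ distributions $\mathcal D\subset T_{\mathbb C}U$ spanned by choosing one vector from each of the pairs $(V_\mu,V^\mu)$ are pairwise distinct at every point, and each of them 1. is a smooth complex subbundle of rank $m$ that is (maximal) isotropic in the complexification of $K^\perp$, and is integrable: $[\mathcal D,\mathcal D]\subset\mathcal D$; 2. is an integrable CR structure on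 $U$ whenever $\mathcal D\cap\overline{\mathcal D}=0$ on $U$, and $\mathcal D\cap\overline{\mathcal D}=0$ always holds if $g$ is Riemannian (positive definite), so that in this case all $2^m$ of them are integrable CR structures; 3. is such that $\tilde{\mathcal D}=\mathcal D\oplus\langle V_0\rangle$, obtained by adjoining the kernel direction, is a smooth complex subbundle of rank $m+1$ that is integrable: $[\tilde{\mathcal D},\tilde{\mathcal D}]\subset\tilde{\mathcal D}$. -/

import Mathlib

open scoped Manifold ContDiff TensorProduct Bundle
open Bundle

noncomputable section
namespace CKY

section
variable {n : ℕ} {M : Type*} [TopologicalSpace M] [ChartedSpace (EuclideanSpace ℝ (Fin n)) M]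
  [IsManifold (𝓡 n) ∞ M]

/-- A smooth field of bilinear forms on the tangent spaces of a smooth `n`-manifold `M`. -/
structure Tensor2 (n : ℕ) (M : Type*) [TopologicalSpace M]
    [ChartedSpace (EuclideanSpace ℝ (Fin n)) M] [IsManifold (𝓡 n) ∞ M] where
  form (x : M) : TangentSpace (𝓡 n) x →L[ℝ] TangentSpace (𝓡 n) x →L[ℝ] ℝ
  smooth : ContMDiff (𝓡 n)
    ((𝓡 n).prod 𝓘(ℝ, EuclideanSpace ℝ (Fin n) →L[ℝ] EuclideanSpace ℝ (Fin n) →L[ℝ] ℝ)) ∞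
    (fun x ↦ TotalSpace.mk'
      (EuclideanSpace ℝ (Fin n) →L[ℝ] EuclideanSpace ℝ (Fin n) →L[ℝ] ℝ)
      (E := fun x ↦ TangentSpace (𝓡 n) x →L[ℝ] TangentSpace (𝓡 n) x →L[ℝ] ℝ) x (form x))

/-- A smooth pseudo-Riemannian metric, of arbitrary signature. -/
structure PseudoRiemannianMetric (n : ℕ) (M : Type*) [TopologicalSpace M]
    [ChartedSpace (EuclideanSpace ℝ (Fin n)) M] [IsManifold (𝓡 n) ∞ M] extends Tensor2 n M where
  symm (x : M) (u v : TangentSpace (𝓡 n) x) : form x u v = form x v u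
  nondegenerate (x : M) (u : TangentSpace (𝓡 n) x) : (∀ v, form x u v = 0) → u = 0

/-- The (rough) vector field `X` is differentiable at `x`. -/
abbrev DiffAt (X : Π x : M, TangentSpace (𝓡 n) x) (x : M) : Prop :=
  MDifferentiableAt (𝓡 n) (𝓡 n).tangent (fun y ↦ (⟨y, X y⟩ : TangentBundle (𝓡 n) M)) x

theorem Tensor2.mdiff (g : Tensor2 n M) {X Y : Π x : M, TangentSpace (𝓡 n) x} {x : M}
    (hX : DiffAt X x) (hY : DiffAt Y x) :
    MDifferentiableAt (𝓡 n) 𝓘(ℝ, ℝ) (fun y ↦ g.form y (X y) (Y y)) x := by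
  have h1 := (g.smooth.contMDiffAt (x := x)).mdifferentiableAt (by simp)
  have h2 : MDifferentiableAt (𝓡 n) ((𝓡 n).prod 𝓘(ℝ))
      (fun m ↦ TotalSpace.mk' ℝ (E := Bundle.Trivial M ℝ) m (g.form m (X m) (Y m))) x :=
    MDifferentiableAt.clm_bundle_apply₂ (F₁ := EuclideanSpace ℝ (Fin n))
      (F₂ := EuclideanSpace ℝ (Fin n)) h1 hX hY
  simp only [mdifferentiableAt_totalSpace] at h2
  exact h2.2

namespace PseudoRiemannianMetric

/-- The affine connection `D` is torsion-free and compatible with `g`.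
`D Y x u` is the covariant derivative of the field `Y` at `x` in the direction `u`. -/
def IsLeviCivita (g : PseudoRiemannianMetric n M)
    (D : CovariantDerivative (𝓡 n) (EuclideanSpace ℝ (Fin n))
      (TangentSpace (𝓡 n) : M → Type _)) : Prop :=
  D.torsion = 0 ∧
  ∀ (x : M) (Y Z : Π x : M, TangentSpace (𝓡 n) x) (u : TangentSpace (𝓡 n) x),
    DiffAt Y x → DiffAt Z x →
    mvfderiv (𝓡 n) (fun y ↦ g.form y (Y y) (Z y)) x u =
      g.form x (D Y x u) (Z x) + g.form x (Y x) (D Z x u)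

/-- The right-hand side of the Koszul formula for `2 g(∇_X Y, Z)`. -/
def koszul (g : PseudoRiemannianMetric n M) (X Y Z : Π x : M, TangentSpace (𝓡 n) x) (x : M) : ℝ :=
  mvfderiv (𝓡 n) (fun y ↦ g.form y (Y y) (Z y)) x (X x)
  + mvfderiv (𝓡 n) (fun y ↦ g.form y (X y) (Z y)) x (Y x)
  - mvfderiv (𝓡 n) (fun y ↦ g.form y (X y) (Y y)) x (Z x)
  + g.form x (VectorField.mlieBracket (𝓡 n) X Y x) (Z x)
  - g.form x (VectorField.mlieBracket (𝓡 n) X Z x) (Y x)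
  - g.form x (VectorField.mlieBracket (𝓡 n) Y Z x) (X x)

variable (g : PseudoRiemannianMetric n M) {X X' Y Y' Z Z' : Π x : M, TangentSpace (𝓡 n) x} {x : M}
  {f : M → ℝ}

theorem deriv_smul_left (hf : MDifferentiableAt (𝓡 n) 𝓘(ℝ, ℝ) f x) (hX : DiffAt X x)
    (hY : DiffAt Y x) (u : TangentSpace (𝓡 n) x) :
    mvfderiv (𝓡 n) (fun y ↦ g.form y ((f • X) y) (Y y)) x u =
      f x * mvfderiv (𝓡 n) (fun y ↦ g.form y (X y) (Y y)) x u +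
        g.form x (X x) (Y x) * mvfderiv (𝓡 n) f x u := by
  have := mvfderiv_fun_mul hf (g.mdiff hX hY)
  simpa using congr($this u)

theorem deriv_smul_right (hf : MDifferentiableAt (𝓡 n) 𝓘(ℝ, ℝ) f x) (hX : DiffAt X x)
    (hY : DiffAt Y x) (u : TangentSpace (𝓡 n) x) :
    mvfderiv (𝓡 n) (fun y ↦ g.form y (X y) ((f • Y) y)) x u =
      f x * mvfderiv (𝓡 n) (fun y ↦ g.form y (X y) (Y y)) x u +
        g.form x (X x) (Y x) * mvfderiv (𝓡 n) f x u := by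
  have := mvfderiv_fun_mul hf (g.mdiff hX hY)
  simpa using congr($this u)

theorem deriv_add_left (hX : DiffAt X x) (hX' : DiffAt X' x)
    (hY : DiffAt Y x) (u : TangentSpace (𝓡 n) x) :
    mvfderiv (𝓡 n) (fun y ↦ g.form y ((X + X') y) (Y y)) x u =
      mvfderiv (𝓡 n) (fun y ↦ g.form y (X y) (Y y)) x u +
        mvfderiv (𝓡 n) (fun y ↦ g.form y (X' y) (Y y)) x u := by
  have := mvfderiv_fun_add (g.mdiff hX hY) (g.mdiff hX' hY)
  simpa using congr($this u)

theorem deriv_add_right (hX : DiffAt X x) (hY : DiffAt Y x)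
    (hY' : DiffAt Y' x) (u : TangentSpace (𝓡 n) x) :
    mvfderiv (𝓡 n) (fun y ↦ g.form y (X y) ((Y + Y') y)) x u =
      mvfderiv (𝓡 n) (fun y ↦ g.form y (X y) (Y y)) x u +
        mvfderiv (𝓡 n) (fun y ↦ g.form y (X y) (Y' y)) x u := by
  have := mvfderiv_fun_add (g.mdiff hX hY) (g.mdiff hX hY')
  simpa using congr($this u)

theorem koszul_tensorial_left (hY : DiffAt Y x) (hZ : DiffAt Z x) :
    TensorialAt (𝓡 n) (EuclideanSpace ℝ (Fin n)) (fun X ↦ g.koszul X Y Z x) x where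
  smul {f X} hf hX := by
    simp only [koszul, deriv_smul_left g hf hX hZ, deriv_smul_left g hf hX hY,
      VectorField.mlieBracket_smul_left hf hX]
    simp
    ring
  add {X X'} hX hX' := by
    simp only [koszul, deriv_add_left g hX hX' hZ, deriv_add_left g hX hX' hY,
      VectorField.mlieBracket_add_left hX hX']
    simp
    ring

theorem koszul_tensorial_right (hX : DiffAt X x) (hY : DiffAt Y x) :
    TensorialAt (𝓡 n) (EuclideanSpace ℝ (Fin n)) (fun Z ↦ g.koszul X Y Z x) x where
  smul {f Z} hf hZ := by
    simp only [koszul, deriv_smul_right g hf hX hZ, deriv_smul_right g hf hY hZ,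
      VectorField.mlieBracket_smul_right hf hZ]
    simp [g.symm x (Z x)]
    ring
  add {Z Z'} hZ hZ' := by
    simp only [koszul, deriv_add_right g hX hZ hZ', deriv_add_right g hY hZ hZ',
      VectorField.mlieBracket_add_right hZ hZ']
    simp
    ring

theorem koszul_add (hX : DiffAt X x) (hY : DiffAt Y x) (hY' : DiffAt Y' x) (hZ : DiffAt Z x) :
    g.koszul X (Y + Y') Z x = g.koszul X Y Z x + g.koszul X Y' Z x := by
  simp only [koszul, deriv_add_left g hY hY' hZ, deriv_add_right g hX hY hY',
      VectorField.mlieBracket_add_left hY hY', VectorField.mlieBracket_add_right hY hY']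
  simp
  ring

theorem koszul_smul (hf : MDifferentiableAt (𝓡 n) 𝓘(ℝ, ℝ) f x)
    (hX : DiffAt X x) (hY : DiffAt Y x) (hZ : DiffAt Z x) :
    g.koszul X (f • Y) Z x = f x * g.koszul X Y Z x
      + 2 * mvfderiv (𝓡 n) f x (X x) * g.form x (Y x) (Z x) := by
  simp only [koszul, deriv_smul_left g hf hY hZ, deriv_smul_right g hf hX hY,
      VectorField.mlieBracket_smul_left hf hY, VectorField.mlieBracket_smul_right hf hY]
  simp [g.symm x (Y x) (X x)]
  ring

theorem koszul_sub :
    g.koszul X Y Z x - g.koszul Y X Z x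
      = 2 * g.form x (VectorField.mlieBracket (𝓡 n) X Y x) (Z x) := by
  have h : (fun y ↦ g.form y (X y) (Y y)) = fun y ↦ g.form y (Y y) (X y) := by
    ext y; exact g.symm _ _ _
  simp only [koszul, VectorField.mlieBracket_swap_apply (V := Y) (W := X), h]
  simp
  ring

theorem koszul_add_swap :
    g.koszul X Y Z x + g.koszul X Z Y x
      = 2 * mvfderiv (𝓡 n) (fun y ↦ g.form y (Y y) (Z y)) x (X x) := by
  have h : (fun y ↦ g.form y (Z y) (Y y)) = fun y ↦ g.form y (Y y) (Z y) := by
    ext y; exact g.symm _ _ _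
  simp only [koszul, VectorField.mlieBracket_swap_apply (V := Z) (W := Y), h]
  simp
  ring

instance (x : M) : FiniteDimensional ℝ (TangentSpace (𝓡 n) x) :=
  inferInstanceAs (FiniteDimensional ℝ (EuclideanSpace ℝ (Fin n)))

instance (x : M) : T2Space (TangentSpace (𝓡 n) x) :=
  inferInstanceAs (T2Space (EuclideanSpace ℝ (Fin n)))

/-- The metric at `x` as a bilinear form. -/
def bilin (x : M) : LinearMap.BilinForm ℝ (TangentSpace (𝓡 n) x) :=
  (ContinuousLinearMap.coeLM ℝ).comp (g.form x).toLinearMap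

theorem bilin_nondegenerate (x : M) : (g.bilin x).Nondegenerate := by
  constructor
  · intro u h
    exact g.nondegenerate x u h
  · intro u h
    exact g.nondegenerate x u fun v ↦ by rw [g.symm]; exact h v

/-- The vector `v` with `g(v, ·) = f`. -/
def sharp (x : M) : Module.Dual ℝ (TangentSpace (𝓡 n) x) ≃ₗ[ℝ] TangentSpace (𝓡 n) x :=
  ((g.bilin x).toDual (g.bilin_nondegenerate x)).symm

theorem form_sharp (x : M) (f : Module.Dual ℝ (TangentSpace (𝓡 n) x))
    (w : TangentSpace (𝓡 n) x) : g.form x (g.sharp x f) w = f w :=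
  LinearMap.BilinForm.apply_toDual_symm_apply (hB := g.bilin_nondegenerate x) f w

theorem ext_form {u v : TangentSpace (𝓡 n) x} (h : ∀ w, g.form x u w = g.form x v w) : u = v := by
  rw [← sub_eq_zero]
  exact g.nondegenerate x _ fun w ↦ by simp [h w]

open Classical in
/-- The covariant derivative defined by the Koszul formula. -/
def lcFun (Y : Π x : M, TangentSpace (𝓡 n) x) (x : M) :
    TangentSpace (𝓡 n) x →L[ℝ] TangentSpace (𝓡 n) x :=
  if hY : DiffAt Y x then
    (2⁻¹ : ℝ) • LinearMap.toContinuousLinearMap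
     ((g.sharp x).toLinearMap ∘ₗ (ContinuousLinearMap.coeLM ℝ) ∘ₗ
      (TensorialAt.mkHom₂ (I := 𝓡 n) (F := EuclideanSpace ℝ (Fin n))
        (F' := EuclideanSpace ℝ (Fin n)) (fun X Z ↦ g.koszul X Y Z x) x
        (fun _ hZ ↦ g.koszul_tensorial_left hY hZ)
        (fun _ hX ↦ g.koszul_tensorial_right hX hY)).toLinearMap)
  else 0

theorem lcFun_spec (hX : DiffAt X x) (hY : DiffAt Y x) (hZ : DiffAt Z x) :
    2 * g.form x (g.lcFun Y x (X x)) (Z x) = g.koszul X Y Z x := by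
  rw [lcFun, dif_pos hY]
  simp only [smul_apply, map_smul, smul_eq_mul]
  have := TensorialAt.mkHom₂_apply (I := 𝓡 n) (F := EuclideanSpace ℝ (Fin n))
        (F' := EuclideanSpace ℝ (Fin n)) (Φ := fun X Z ↦ g.koszul X Y Z x) (x := x)
        (fun _ hZ ↦ g.koszul_tensorial_left hY hZ)
        (fun _ hX ↦ g.koszul_tensorial_right hX hY) hX hZ
  rw [← this]
  simp [form_sharp]

theorem diffAt_extend (u : TangentSpace (𝓡 n) x) :
    DiffAt (FiberBundle.extend (EuclideanSpace ℝ (Fin n)) u) x :=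
  FiberBundle.mdifferentiableAt_extend ..

theorem exists_isLeviCivita : ∃ D, g.IsLeviCivita D := by
  have ext (x : M) {A B : TangentSpace (𝓡 n) x →L[ℝ] TangentSpace (𝓡 n) x}
      (h : ∀ X Z : Π x : M, TangentSpace (𝓡 n) x, DiffAt X x → DiffAt Z x →
        2 * g.form x (A (X x)) (Z x) = 2 * g.form x (B (X x)) (Z x)) : A = B := by
    ext1 u
    refine g.ext_form fun w ↦ ?_
    have := h _ _ (diffAt_extend u) (diffAt_extend w)
    simpa using this
  let D : CovariantDerivative (𝓡 n) (EuclideanSpace ℝ (Fin n))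
      (TangentSpace (𝓡 n) : M → Type _) :=
    { toFun := g.lcFun
      isCovariantDerivativeOnUniv :=
        { add := by
            intro σ σ' x hσ hσ' _
            refine ext x fun X Z hX hZ ↦ ?_
            have h3 : DiffAt (σ + σ') x := mdifferentiableAt_add_section hσ hσ'
            rw [g.lcFun_spec hX h3 hZ, g.koszul_add hX hσ hσ' hZ, ← g.lcFun_spec hX hσ hZ,
              ← g.lcFun_spec hX hσ' hZ]
            simp
            ring
          leibniz := by
            intro σ f x hσ hf _
            refine ext x fun X Z hX hZ ↦ ?_
            have h3 : DiffAt (f • σ) x := hf.smul_section hσ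
            rw [g.lcFun_spec hX h3 hZ, g.koszul_smul hf hX hσ hZ, ← g.lcFun_spec hX hσ hZ]
            simp
            ring } }
  refine ⟨D, ?_, ?_⟩
  · rw [D.torsion_eq_zero_iff]
    intro X Y x hX hY
    refine g.ext_form fun w ↦ ?_
    have h1 := g.lcFun_spec hX hY (diffAt_extend w)
    have h2 := g.lcFun_spec hY hX (diffAt_extend w)
    have h3 := g.koszul_sub (X := X) (Y := Y)
      (Z := FiberBundle.extend (EuclideanSpace ℝ (Fin n)) w) (x := x)
    rw [FiberBundle.extend_apply_self] at h1 h2 h3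
    change g.form x (g.lcFun Y x (X x) - g.lcFun X x (Y x)) w = _
    simp only [map_sub, sub_apply]
    linarith
  · intro x Y Z u hY hZ
    have h1 := g.lcFun_spec (diffAt_extend u) hY hZ
    have h2 := g.lcFun_spec (diffAt_extend u) hZ hY
    have h3 := g.koszul_add_swap (X := FiberBundle.extend (EuclideanSpace ℝ (Fin n)) u) (Y := Y)
      (Z := Z) (x := x)
    rw [FiberBundle.extend_apply_self] at h1 h2 h3
    rw [g.symm x (Y x)]
    change _ = g.form x (g.lcFun Y x u) (Z x) + g.form x (g.lcFun Z x u) (Y x)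
    linarith

/-- The Levi-Civita connection of `g`. -/
def leviCivita : CovariantDerivative (𝓡 n) (EuclideanSpace ℝ (Fin n))
    (TangentSpace (𝓡 n) : M → Type _) := g.exists_isLeviCivita.choose

theorem leviCivita_spec : g.IsLeviCivita g.leviCivita := g.exists_isLeviCivita.choose_spec

/-- A Levi-Civita connection satisfies the Koszul formula; hence it is unique on
differentiable fields. -/
theorem IsLeviCivita.koszul_eq {D : CovariantDerivative (𝓡 n) (EuclideanSpace ℝ (Fin n))
    (TangentSpace (𝓡 n) : M → Type _)} (h : g.IsLeviCivita D)
    (hX : DiffAt X x) (hY : DiffAt Y x) (hZ : DiffAt Z x) :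
    2 * g.form x (D Y x (X x)) (Z x) = g.koszul X Y Z x := by
  have ht {X Y : Π x : M, TangentSpace (𝓡 n) x} (hX : DiffAt X x) (hY : DiffAt Y x) :
      D Y x (X x) - D X x (Y x) = VectorField.mlieBracket (𝓡 n) X Y x :=
    (D.torsion_eq_zero_iff).1 h.1 hX hY
  simp only [koszul, h.2 x Y Z (X x) hY hZ, h.2 x X Z (Y x) hX hZ, h.2 x X Y (Z x) hX hY,
    ← ht hX hY, ← ht hX hZ, ← ht hY hZ, map_sub, sub_apply, g.symm x (X x), g.symm x (Y x)]
  ring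

/-- The metric is positive definite. -/
def IsRiemannian (g : PseudoRiemannianMetric n M) : Prop :=
  ∀ (x : M) (u : TangentSpace (𝓡 n) x), u ≠ 0 → 0 < g.form x u u

end PseudoRiemannianMetric

/-- A smooth real differential 2-form. -/
structure TwoForm (n : ℕ) (M : Type*) [TopologicalSpace M]
    [ChartedSpace (EuclideanSpace ℝ (Fin n)) M] [IsManifold (𝓡 n) ∞ M] extends Tensor2 n M where
  alt (x : M) (u : TangentSpace (𝓡 n) x) : form x u u = 0

/-- `(∇_u φ)(Y, Z)` at the point `x`, for the Levi-Civita connection of `g`. -/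
def covDeriv (g : PseudoRiemannianMetric n M) (φ : TwoForm n M) (x : M)
    (u : TangentSpace (𝓡 n) x) (Y Z : Π x : M, TangentSpace (𝓡 n) x) : ℝ :=
  mvfderiv (𝓡 n) (fun y ↦ φ.form y (Y y) (Z y)) x u
    - φ.form x (g.leviCivita Y x u) (Z x) - φ.form x (Y x) (g.leviCivita Z x u)

/-- `φ` is a conformal Killing-Yano tensor (conformal Killing 2-form): for some 3-form `τ` and
some 1-form `K`, `∇_X φ = (1/3) X ⌟ τ + (1/(n-1)) X* ∧ K` for all `X`. -/
def IsConformalKillingYano (g : PseudoRiemannianMetric n M) (φ : TwoForm n M) : Prop :=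
  ∃ (τ : Π x : M, TangentSpace (𝓡 n) x [⋀^Fin 3]→ₗ[ℝ] ℝ)
    (K : Π x : M, Module.Dual ℝ (TangentSpace (𝓡 n) x)),
    ∀ (x : M) (u : TangentSpace (𝓡 n) x) (Y Z : Π x : M, TangentSpace (𝓡 n) x),
      DiffAt Y x → DiffAt Z x →
      covDeriv g φ x u Y Z = 1 / 3 * τ x ![u, Y x, Z x]
        + 1 / ((n : ℝ) - 1) * (g.form x u (Y x) * K x (Z x) - g.form x u (Z x) * K x (Y x))

/-- The exterior derivative `dφ` at `x`, evaluated on tangent vectors by the invariant formula,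
which is independent of the fields that extend these vectors. -/
def TwoForm.extDeriv (φ : TwoForm n M) (x : M) (u v w : TangentSpace (𝓡 n) x) : ℝ :=
  let X : Π y : M, TangentSpace (𝓡 n) y := FiberBundle.extend (EuclideanSpace ℝ (Fin n)) u
  let Y : Π y : M, TangentSpace (𝓡 n) y := FiberBundle.extend (EuclideanSpace ℝ (Fin n)) v
  let Z : Π y : M, TangentSpace (𝓡 n) y := FiberBundle.extend (EuclideanSpace ℝ (Fin n)) w
  mvfderiv (𝓡 n) (fun y ↦ φ.form y (Y y) (Z y)) x u
  - mvfderiv (𝓡 n) (fun y ↦ φ.form y (X y) (Z y)) x v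
  + mvfderiv (𝓡 n) (fun y ↦ φ.form y (X y) (Y y)) x w
  - φ.form x (VectorField.mlieBracket (𝓡 n) X Y x) w
  + φ.form x (VectorField.mlieBracket (𝓡 n) X Z x) v
  - φ.form x (VectorField.mlieBracket (𝓡 n) Y Z x) u

/-- The endomorphism `φ^♯` of `T_x M` obtained from `φ` by raising an index:
`g(φ^♯ u, v) = φ(u, v)`. -/
def raise (g : PseudoRiemannianMetric n M) (φ : TwoForm n M) (x : M) :
    TangentSpace (𝓡 n) x →ₗ[ℝ] TangentSpace (𝓡 n) x :=
  (g.sharp x).toLinearMap ∘ₗ (ContinuousLinearMap.coeLM ℝ) ∘ₗ (φ.form x).toLinearMap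

theorem form_raise (g : PseudoRiemannianMetric n M) (φ : TwoForm n M) (x : M)
    (u v : TangentSpace (𝓡 n) x) : g.form x (raise g φ x u) v = φ.form x u v := by
  simp [raise, g.form_sharp]

/-- On a manifold of dimension `2m + 1`: at `x` the (complex) non-zero eigenvalues of `φ^♯` are
`2m` distinct numbers, and the kernel of `φ^♯` is one-dimensional. -/
def IsGenericAt (m : ℕ) (g : PseudoRiemannianMetric n M) (φ : TwoForm n M) (x : M) : Prop :=
  {c : ℂ | c ≠ 0 ∧ Module.End.HasEigenvalue ((raise g φ x).baseChange ℂ) c}.ncard = 2 * m ∧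
  Module.finrank ℝ (LinearMap.ker (raise g φ x)) = 1

/-! ### The complexified tangent bundle -/

/-- The complexified tangent space at `x`. -/
abbrev CTangent (n : ℕ) {M : Type*} [TopologicalSpace M]
    [ChartedSpace (EuclideanSpace ℝ (Fin n)) M] (x : M) : Type :=
  ℂ ⊗[ℝ] TangentSpace (𝓡 n) x

section Complexification
variable {T : Type*} [AddCommGroup T] [Module ℝ T]

/-- The real part of a complexified vector. -/
def rePart : ℂ ⊗[ℝ] T →ₗ[ℝ] T := (TensorProduct.lid ℝ T).toLinearMap ∘ₗ Complex.reLm.rTensor T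

/-- The imaginary part of a complexified vector. -/
def imPart : ℂ ⊗[ℝ] T →ₗ[ℝ] T := (TensorProduct.lid ℝ T).toLinearMap ∘ₗ Complex.imLm.rTensor T

/-- The vector `a + i b`. -/
def ofParts (a b : T) : ℂ ⊗[ℝ] T := 1 ⊗ₜ[ℝ] a + Complex.I ⊗ₜ[ℝ] b

theorem rePart_ofParts (a b : T) : rePart (ofParts a b) = a := by
  simp [rePart, ofParts]

theorem imPart_ofParts (a b : T) : imPart (ofParts a b) = b := by
  simp [imPart, ofParts]

theorem ofParts_parts (z : ℂ ⊗[ℝ] T) : ofParts (rePart z) (imPart z) = z := by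
  induction z using TensorProduct.induction_on with
  | zero => simp [ofParts]
  | add a b ha hb =>
    rw [map_add, map_add]
    conv_rhs => rw [← ha, ← hb]
    simp only [ofParts, TensorProduct.tmul_add]
    abel
  | tmul c t =>
    simp only [ofParts, rePart, imPart, LinearMap.comp_apply, LinearMap.rTensor_tmul,
      LinearEquiv.coe_coe, TensorProduct.lid_tmul, TensorProduct.tmul_smul,
      TensorProduct.smul_tmul', ← TensorProduct.add_tmul]
    congr 1
    apply Complex.ext <;> simp

/-- Complex conjugation of complexified vectors. -/
def conjVec : ℂ ⊗[ℝ] T →ₗ[ℝ] ℂ ⊗[ℝ] T := Complex.conjAe.toLinearMap.rTensor T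

/-- The complex conjugate of a complex subspace. -/
def conjSubspace (D : Submodule ℂ (ℂ ⊗[ℝ] T)) : Submodule ℂ (ℂ ⊗[ℝ] T) :=
  Submodule.span ℂ (conjVec '' (D : Set (ℂ ⊗[ℝ] T)))

/-- The complex-linear extension of a real-linear function. -/
def cExt (f : T → ℂ) (z : ℂ ⊗[ℝ] T) : ℂ := f (rePart z) + Complex.I * f (imPart z)

/-- The complex-bilinear extension of a real-bilinear form. -/
def cExt₂ (B : T → T → ℝ) (z w : ℂ ⊗[ℝ] T) : ℂ :=
  cExt (fun a ↦ cExt (fun b ↦ (B a b : ℂ)) w) z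

/-- The complex-trilinear extension of a real-trilinear form. -/
def cExt₃ (B : T → T → T → ℝ) (z w t : ℂ ⊗[ℝ] T) : ℂ :=
  cExt (fun a ↦ cExt₂ (B a) w t) z

end Complexification

/-- The complex-bilinear extension of the metric. -/
def gC (g : PseudoRiemannianMetric n M) (x : M) (z w : CTangent n x) : ℂ :=
  cExt₂ (fun a b ↦ g.form x a b) z w

/-- The complex-bilinear extension of the 2-form. -/
def formC (φ : TwoForm n M) (x : M) (z w : CTangent n x) : ℂ :=
  cExt₂ (fun a b ↦ φ.form x a b) z w

/-- The complex-trilinear extension of `dφ`. -/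
def extDerivC (φ : TwoForm n M) (x : M) (z w t : CTangent n x) : ℂ :=
  cExt₃ (φ.extDeriv x) z w t

/-- The complex vector field `V` is smooth on `U`. -/
def SmoothFieldOn (V : Π x : M, CTangent n x) (U : Set M) : Prop :=
  ContMDiffOn (𝓡 n) (𝓡 n).tangent ∞
    (fun x ↦ (⟨x, rePart (V x)⟩ : TangentBundle (𝓡 n) M)) U ∧
  ContMDiffOn (𝓡 n) (𝓡 n).tangent ∞
    (fun x ↦ (⟨x, imPart (V x)⟩ : TangentBundle (𝓡 n) M)) U

/-- The complex-bilinear extension of the Lie bracket of vector fields. -/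
def lieBracketC (V W : Π x : M, CTangent n x) (x : M) : CTangent n x :=
  ofParts
    (VectorField.mlieBracket (𝓡 n) (fun y ↦ rePart (V y)) (fun y ↦ rePart (W y)) x
      - VectorField.mlieBracket (𝓡 n) (fun y ↦ imPart (V y)) (fun y ↦ imPart (W y)) x)
    (VectorField.mlieBracket (𝓡 n) (fun y ↦ rePart (V y)) (fun y ↦ imPart (W y)) x
      + VectorField.mlieBracket (𝓡 n) (fun y ↦ imPart (V y)) (fun y ↦ rePart (W y)) x)

/-- `D` is a smooth complex subbundle of rank `r` of the complexified tangent bundle over `U`. -/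
def IsSubbundleOn (r : ℕ) (D : Π x : M, Submodule ℂ (CTangent n x)) (U : Set M) : Prop :=
  ∀ x ∈ U, ∃ U' ⊆ U, IsOpen U' ∧ x ∈ U' ∧ ∃ e : Fin r → Π x : M, CTangent n x,
    (∀ i, SmoothFieldOn (e i) U') ∧
    ∀ y ∈ U', LinearIndependent ℂ (fun i ↦ e i y) ∧
      Submodule.span ℂ (Set.range fun i ↦ e i y) = D y

/-- Frobenius integrability `[D, D] ⊆ D` over `U`: the bracket of any two smooth local sections
of `D` is a section of `D`. -/
def IsIntegrableOn (D : Π x : M, Submodule ℂ (CTangent n x)) (U : Set M) : Prop :=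
  ∀ U' ⊆ U, IsOpen U' → ∀ V W : Π x : M, CTangent n x,
    SmoothFieldOn V U' → SmoothFieldOn W U' →
    (∀ x ∈ U', V x ∈ D x) → (∀ x ∈ U', W x ∈ D x) → ∀ x ∈ U', lieBracketC V W x ∈ D x

/-- `D` is an (integrable) CR structure over `U`, of complex rank `m`. -/
structure IsCRStructureOn (m : ℕ) (D : Π x : M, Submodule ℂ (CTangent n x)) (U : Set M) :
    Prop where
  subbundle : IsSubbundleOn m D U
  inf_conj : ∀ x ∈ U, D x ⊓ conjSubspace (D x) = ⊥
  integrable : IsIntegrableOn D U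

/-! ### Normal form, and the distributions associated with a 2-form -/

/-- The vectors `v0, v i, w i` (written `V_0, V_μ, V^μ` on paper) of the complexified tangent space
at `x` put `g` and `φ` in normal form. With the dual basis `e⁰, θ^μ, θ_μ`, where
`θ^μ = g(V^μ, ·)` and `θ_μ = g(V_μ, ·)`, these are the relations
`g = e⁰ ⊗ e⁰ + ∑ (θ^μ ⊗ θ_μ + θ_μ ⊗ θ^μ)` and `φ = ∑ λ_μ θ^μ ∧ θ_μ`. -/
structure IsNormalBasisAt {m : ℕ} (g : PseudoRiemannianMetric n M) (φ : TwoForm n M) (x : M)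
    (lam : Fin m → ℂ) (v0 : CTangent n x) (v w : Fin m → CTangent n x) : Prop where
  g_vv (i j : Fin m) : gC g x (v i) (v j) = 0
  g_ww (i j : Fin m) : gC g x (w i) (w j) = 0
  g_vw (i j : Fin m) : gC g x (v i) (w j) = if i = j then 1 else 0
  g_v0 (i : Fin m) : gC g x (v i) v0 = 0
  g_w0 (i : Fin m) : gC g x (w i) v0 = 0
  g_00 : gC g x v0 v0 = 1
  phi_vv (i j : Fin m) : formC φ x (v i) (v j) = 0
  phi_ww (i j : Fin m) : formC φ x (w i) (w j) = 0
  phi_vw (i j : Fin m) : formC φ x (v i) (w j) = if i = j then lam i else 0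
  phi_v0 (i : Fin m) : formC φ x (v i) v0 = 0
  phi_w0 (i : Fin m) : formC φ x (w i) v0 = 0

/-- A smooth normal form frame for `g` and `φ` over `U`, with eigenvalue functions `lam i`. -/
structure IsNormalFrameOn {m : ℕ} (g : PseudoRiemannianMetric n M) (φ : TwoForm n M) (U : Set M)
    (lam : Fin m → M → ℂ) (V0 : Π x : M, CTangent n x)
    (V W : Fin m → Π x : M, CTangent n x) : Prop where
  smooth_V0 : SmoothFieldOn V0 U
  smooth_V (i : Fin m) : SmoothFieldOn (V i) U
  smooth_W (i : Fin m) : SmoothFieldOn (W i) U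
  normal : ∀ x ∈ U, IsNormalBasisAt g φ x (fun i ↦ lam i x) (V0 x) (fun i ↦ V i x) (fun i ↦ W i x)

/-- The condition on `τ = dφ` at `x`, in components with respect to every normal form basis at
`x` (it does not depend on the basis): all components of `τ` vanish except those of the form
`τ(V_μ, V^μ, ·)`. -/
def TauConditionAt (m : ℕ) (g : PseudoRiemannianMetric n M) (φ : TwoForm n M) (x : M) : Prop :=
  ∀ (lam : Fin m → ℂ) (v0 : CTangent n x) (v w : Fin m → CTangent n x),
    IsNormalBasisAt g φ x lam v0 v w →
    (∀ k i j, extDerivC φ x (v k) (v i) (v j) = 0 ∧ extDerivC φ x (w k) (w i) (w j) = 0) ∧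
    (∀ k i j, j ≠ i → j ≠ k →
      extDerivC φ x (v k) (v i) (w j) = 0 ∧ extDerivC φ x (w k) (w i) (v j) = 0) ∧
    (∀ i j, i ≠ j → extDerivC φ x (v i) (v j) v0 = 0 ∧ extDerivC φ x (w i) (w j) v0 = 0 ∧
      extDerivC φ x (v i) (w j) v0 = 0)

theorem gC_symm (g : PseudoRiemannianMetric n M) (x : M) (z w : CTangent n x) :
    gC g x z w = gC g x w z := by
  simp only [gC, cExt₂, cExt, g.symm x (rePart w), g.symm x (imPart w)]
  ring

/-- The condition on `τ` holds if `θ^μ ∧ τ(V^μ, ·, ·) = 0` and `θ_μ ∧ τ(V_μ, ·, ·) = 0`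
for every `μ`, where `θ^μ = g(V^μ, ·)` and `θ_μ = g(V_μ, ·)`. -/
theorem tauConditionAt_of_wedge {m : ℕ} (g : PseudoRiemannianMetric n M) (φ : TwoForm n M) (x : M)
    (h : ∀ (lam : Fin m → ℂ) (v0 : CTangent n x) (v w : Fin m → CTangent n x),
      IsNormalBasisAt g φ x lam v0 v w → ∀ (i : Fin m) (a b c : CTangent n x),
        gC g x (w i) a * extDerivC φ x (w i) b c + gC g x (w i) b * extDerivC φ x (w i) c a
          + gC g x (w i) c * extDerivC φ x (w i) a b = 0 ∧
        gC g x (v i) a * extDerivC φ x (v i) b c + gC g x (v i) b * extDerivC φ x (v i) c a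
          + gC g x (v i) c * extDerivC φ x (v i) a b = 0) :
    TauConditionAt m g φ x := by
  intro lam v0 v w hb
  have hwv (i j : Fin m) : gC g x (w i) (v j) = if j = i then 1 else 0 := by
    rw [gC_symm, hb.g_vw]
  refine ⟨fun k i j ↦ ⟨?_, ?_⟩, fun k i j h1 h2 ↦ ⟨?_, ?_⟩, fun i j h1 ↦ ⟨?_, ?_, ?_⟩⟩
  · simpa [hb.g_vw, hb.g_vv] using (h lam v0 v w hb k (w k) (v i) (v j)).2
  · simpa [hwv, hb.g_ww] using (h lam v0 v w hb k (v k) (w i) (w j)).1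
  · simpa [hb.g_vw, hb.g_vv, h2.symm] using (h lam v0 v w hb k (w k) (v i) (w j)).2
  · simpa [hwv, hb.g_ww, h2] using (h lam v0 v w hb k (v k) (w i) (v j)).1
  · simpa [hb.g_vw, hb.g_vv, hb.g_v0] using (h lam v0 v w hb i (w i) (v j) v0).2
  · simpa [hwv, hb.g_ww, hb.g_w0] using (h lam v0 v w hb i (v i) (w j) v0).1
  · simpa [hb.g_vw, hb.g_v0, h1] using (h lam v0 v w hb i (w i) (w j) v0).2

/-- The distribution spanned by choosing one vector from each of the pairs `(V i, W i)`. -/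
def choiceDist {m : ℕ} (V W : Fin m → Π x : M, CTangent n x) (s : Fin m → Bool) (x : M) :
    Submodule ℂ (CTangent n x) :=
  Submodule.span ℂ (Set.range fun i ↦ if s i then V i x else W i x)

/-- The distribution obtained from `choiceDist` by adjoining `V0`. -/
def choiceDistAdjoin {m : ℕ} (V0 : Π x : M, CTangent n x) (V W : Fin m → Π x : M, CTangent n x)
    (s : Fin m → Bool) (x : M) : Submodule ℂ (CTangent n x) :=
  choiceDist V W s x ⊔ Submodule.span ℂ {V0 x}

/-- `D` is an `m`-dimensional isotropic subspace of the complexification of `K^⊥`, where `K` is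
the kernel of `φ` at `x`. For a one-dimensional non-null `K` in dimension `2m + 1` this means that
`D` is maximal isotropic in `K^⊥`. -/
def IsMaximalIsotropic (m : ℕ) (g : PseudoRiemannianMetric n M) (φ : TwoForm n M) (x : M)
    (D : Submodule ℂ (CTangent n x)) : Prop :=
  Module.finrank ℂ D = m ∧ (∀ z ∈ D, ∀ w ∈ D, gC g x z w = 0) ∧
  ∀ z ∈ D, ∀ k ∈ LinearMap.ker (raise g φ x), gC g x z (1 ⊗ₜ[ℝ] k) = 0

end
end CKY
end

/-! Fix a choice `s`, let `X_i` be the vector chosen from the `i`-th pair, and let `c_i = ±λ_i` be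
its eigenvalue, so that `φ(X_i, ·) = c_i g(X_i, ·)`. Since `φ^♯` has `2m` distinct non-zero
eigenvalues, the numbers `±λ_i` are pairwise distinct and non-zero. No two chosen eigenvalues are
therefore opposite, so `c_i + c_j ≠ 0` for all `i, j`, including `i = j`.

On `U` both `g(X_i, X_j)` and `φ(X_i, X_j)` vanish identically. Differentiate both along a direction
`a` orthogonal to `X_i` and `X_j`. In the conformal Killing–Yano equation the `K`-terms carry the
factors `g(a, X_i)` and `g(a, X_j)` and drop out, while the `τ`-term is zero by the condition on
`dφ`. What remains is `(c_i + c_j) g(∇_a X_i, X_j) = 0`, hence `g(∇_a X_i, X_j) = 0`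
(`g_covC_sel_sel`). This applies to `a = X_k` and to `a = V_0`. The same computation with `V_0` in
place of `X_j` gives `c_i g(X_i, ∇_{X_k} V_0) = 0` (`g_covC_sel_kernel`).

These identities imply integrability because the distributions are orthogonal complements: `D = (D ⊕
⟨V_0⟩)^⊥` and `D ⊕ ⟨V_0⟩ = D^⊥` (`mem_span_sel`, `mem_span_sel_sup`). If sections `A, B` are
orthogonal to a field `Z`, then `g([A, B], Z) = g(A, ∇_B Z) - g(B, ∇_A Z)` (`gC_lieBracketC_eq`).
The right-hand side is tensorial in `A` and `B`, so it needs checking only on the frame vectors,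
with `Z = X_k` and, for `D` itself, also `Z = V_0`.

In the Riemannian case `z ∈ D ∩ conj D` gives `0 = g(z, conj z) = |Re z|² + |Im z|²`, so `z = 0`.

Normal form frames exist because `φ^♯` is skew for `g`. Its spectrum is symmetric under `c ↦ -c`,
and eigenvectors with eigenvalues `c, c'` are orthogonal unless `c + c' = 0`. All `2m + 1`
eigenvalues are simple (`eigen_simple`), so the implicit function theorem makes eigenvectors depend
smoothly on the point (`exists_analytic_eigenpair`); rescaling then normalises the non-zero
products. -/

namespace CKY

/-! ### Complexification of vectors, forms and tensors -/

section ComplexAlgebra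
variable {T : Type*} [AddCommGroup T] [Module ℝ T]

theorem rePart_smul (c : ℂ) (z : ℂ ⊗[ℝ] T) :
    rePart (c • z) = c.re • rePart z - c.im • imPart z := by
  induction z using TensorProduct.induction_on with
  | zero => simp
  | add a b ha hb => rw [smul_add, map_add, ha, hb, map_add, map_add]; module
  | tmul d t => simp [TensorProduct.smul_tmul', rePart, imPart]; module

theorem imPart_smul (c : ℂ) (z : ℂ ⊗[ℝ] T) :
    imPart (c • z) = c.re • imPart z + c.im • rePart z := by
  induction z using TensorProduct.induction_on with
  | zero => simp
  | add a b ha hb => rw [smul_add, map_add, ha, hb, map_add, map_add]; module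
  | tmul d t => simp [TensorProduct.smul_tmul', rePart, imPart]; module

theorem ext_parts {z w : ℂ ⊗[ℝ] T} (hr : rePart z = rePart w) (hi : imPart z = imPart w) :
    z = w := by
  rw [← ofParts_parts z, ← ofParts_parts w, hr, hi]

/-- The complex-bilinear extension of a real bilinear form, as a bilinear map. -/
noncomputable def cBilin (B : T →ₗ[ℝ] T →ₗ[ℝ] ℝ) : (ℂ ⊗[ℝ] T) →ₗ[ℂ] (ℂ ⊗[ℝ] T) →ₗ[ℂ] ℂ :=
  LinearMap.mk₂ ℂ (fun z w ↦ cExt₂ (fun a b ↦ B a b) z w)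
    (fun z z' w ↦ by simp [cExt₂, cExt]; ring)
    (fun c z w ↦ by
      simp only [cExt₂, cExt, rePart_smul, imPart_smul, map_sub, map_add, map_smul,
        LinearMap.sub_apply, LinearMap.add_apply, LinearMap.smul_apply, smul_eq_mul]
      apply Complex.ext <;> simp <;> ring)
    (fun z w w' ↦ by simp [cExt₂, cExt]; ring)
    (fun c z w ↦ by
      simp only [cExt₂, cExt, rePart_smul, imPart_smul, map_sub, map_add, map_smul, smul_eq_mul]
      apply Complex.ext <;> simp <;> ring)

theorem cExt₂_one_tmul (B : T →ₗ[ℝ] T →ₗ[ℝ] ℝ) (a b : T) :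
    cExt₂ (fun a b ↦ B a b) ((1 : ℂ) ⊗ₜ[ℝ] a) ((1 : ℂ) ⊗ₜ[ℝ] b) = B a b := by
  simp [cExt₂, cExt, rePart, imPart]

theorem rePart_baseChange (f : T →ₗ[ℝ] T) (z : ℂ ⊗[ℝ] T) :
    rePart (f.baseChange ℂ z) = f (rePart z) := by
  induction z using TensorProduct.induction_on with
  | zero => simp
  | add a b ha hb => rw [map_add, map_add, ha, hb, map_add, map_add]
  | tmul d t => simp [rePart]

theorem imPart_baseChange (f : T →ₗ[ℝ] T) (z : ℂ ⊗[ℝ] T) :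
    imPart (f.baseChange ℂ z) = f (imPart z) := by
  induction z using TensorProduct.induction_on with
  | zero => simp
  | add a b ha hb => rw [map_add, map_add, ha, hb, map_add, map_add]
  | tmul d t => simp [imPart]

theorem cExt₃_swap₁₂ {B : T → T → T → ℝ} (h : ∀ a b c, B b a c = -B a b c) (z w t : ℂ ⊗[ℝ] T) :
    cExt₃ B w z t = -cExt₃ B z w t := by
  simp only [cExt₃, cExt₂, cExt, h (rePart z) (rePart w), h (imPart z) (rePart w),
    h (rePart z) (imPart w), h (imPart z) (imPart w)]
  push_cast
  ring

theorem cExt₃_swap₂₃ {B : T → T → T → ℝ} (h : ∀ a b c, B a c b = -B a b c) (z w t : ℂ ⊗[ℝ] T) :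
    cExt₃ B z t w = -cExt₃ B z w t := by
  simp only [cExt₃, cExt₂, cExt, h _ (rePart w) (rePart t), h _ (imPart w) (rePart t),
    h _ (rePart w) (imPart t), h _ (imPart w) (imPart t)]
  push_cast
  ring

theorem conjVec_ofParts (a b : T) : conjVec (ofParts a b) = ofParts a (-b) := by
  simp [conjVec, ofParts, TensorProduct.neg_tmul, TensorProduct.tmul_neg]

theorem rePart_conjVec (z : ℂ ⊗[ℝ] T) : rePart (conjVec z) = rePart z := by
  rw [← ofParts_parts z, conjVec_ofParts, rePart_ofParts, rePart_ofParts]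

theorem imPart_conjVec (z : ℂ ⊗[ℝ] T) : imPart (conjVec z) = -imPart z := by
  rw [← ofParts_parts z, conjVec_ofParts, imPart_ofParts, imPart_ofParts]

theorem conjVec_smul (c : ℂ) (z : ℂ ⊗[ℝ] T) :
    conjVec (c • z) = (starRingEnd ℂ) c • conjVec z := by
  apply ext_parts
  · rw [rePart_conjVec, rePart_smul, rePart_smul, rePart_conjVec, imPart_conjVec]; simp
  · rw [imPart_conjVec, imPart_smul, imPart_smul, rePart_conjVec, imPart_conjVec]; simp; abel

theorem conjVec_conjVec (z : ℂ ⊗[ℝ] T) : conjVec (conjVec z) = z := by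
  apply ext_parts <;> simp [rePart_conjVec, imPart_conjVec]

theorem conjVec_mem_of_mem_conjSubspace {D : Submodule ℂ (ℂ ⊗[ℝ] T)} {z : ℂ ⊗[ℝ] T}
    (hz : z ∈ conjSubspace D) : conjVec z ∈ D := by
  induction hz using Submodule.span_induction with
  | mem x hx => obtain ⟨y, hy, rfl⟩ := hx; rwa [conjVec_conjVec]
  | zero => simp
  | add x y _ _ hx hy => rw [map_add]; exact D.add_mem hx hy
  | smul c x _ hx => rw [conjVec_smul]; exact D.smul_mem _ hx

end ComplexAlgebra

variable {n : ℕ} {M : Type*} [TopologicalSpace M] [ChartedSpace (EuclideanSpace ℝ (Fin n)) M]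
  [IsManifold (𝓡 n) ∞ M]

/-- The bilinear form given by a tensor at a point. -/
noncomputable def Tensor2.bilin (t : Tensor2 n M) (x : M) :
    TangentSpace (𝓡 n) x →ₗ[ℝ] TangentSpace (𝓡 n) x →ₗ[ℝ] ℝ :=
  (ContinuousLinearMap.coeLM ℝ).comp (t.form x).toLinearMap

/-- The complex-bilinear extension of a tensor at a point. -/
noncomputable def Tensor2.cForm (t : Tensor2 n M) (x : M) : CTangent n x →ₗ[ℂ] CTangent n x →ₗ[ℂ] ℂ :=
  cBilin (t.bilin x)

theorem Tensor2.cForm_apply (t : Tensor2 n M) (x : M) (z w : CTangent n x) :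
    t.cForm x z w = cExt₂ (fun a b ↦ t.form x a b) z w := rfl

theorem gC_eq (g : PseudoRiemannianMetric n M) (x : M) (z w : CTangent n x) :
    gC g x z w = g.cForm x z w := rfl

theorem formC_eq (φ : TwoForm n M) (x : M) (z w : CTangent n x) :
    formC φ x z w = φ.cForm x z w := rfl

theorem PseudoRiemannianMetric.cForm_symm (g : PseudoRiemannianMetric n M) (x : M)
    (z w : CTangent n x) : g.cForm x z w = g.cForm x w z := gC_symm g x z w

theorem TwoForm.form_swap (φ : TwoForm n M) (x : M) (a b : TangentSpace (𝓡 n) x) :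
    φ.form x b a = -φ.form x a b := by
  have := φ.alt x (a + b)
  simp only [map_add, _root_.add_apply, φ.alt] at this
  linarith

theorem TwoForm.cForm_swap (φ : TwoForm n M) (x : M)
    (z w : CTangent n x) : φ.cForm x w z = -φ.cForm x z w := by
  simp only [Tensor2.cForm_apply, cExt₂, cExt, φ.form_swap x (rePart z),
    φ.form_swap x (imPart z)]
  push_cast
  ring

/-- Pairing with real vectors alone separates the real and imaginary parts, so nondegeneracy reduces
to that of the real metric. -/
theorem PseudoRiemannianMetric.cForm_nondegenerate (g : PseudoRiemannianMetric n M) {x : M}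
    {z : CTangent n x} (h : ∀ w, g.cForm x z w = 0) : z = 0 := by
  have key (b : TangentSpace (𝓡 n) x) :
      g.form x (rePart z) b = 0 ∧ g.form x (imPart z) b = 0 := by
    have := h (ofParts b 0)
    simp only [Tensor2.cForm_apply, cExt₂, cExt, rePart_ofParts, imPart_ofParts, map_zero,
      Complex.ofReal_zero, mul_zero, add_zero] at this
    have hr := congrArg Complex.re this
    have hi := congrArg Complex.im this
    simp at hr hi
    exact ⟨hr, hi⟩
  exact ext_parts (by simpa using g.nondegenerate x _ fun b ↦ (key b).1)
    (by simpa using g.nondegenerate x _ fun b ↦ (key b).2)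

theorem cForm_baseChange_raise (g : PseudoRiemannianMetric n M) (φ : TwoForm n M) (x : M)
    (z w : CTangent n x) :
    g.cForm x ((raise g φ x).baseChange ℂ z) w = φ.cForm x z w := by
  simp only [Tensor2.cForm_apply, cExt₂, cExt, rePart_baseChange, imPart_baseChange, form_raise]

theorem finrank_cTangent (x : M) : Module.finrank ℂ (CTangent n x) = n := by
  rw [Module.finrank_baseChange]
  exact finrank_euclideanSpace_fin

instance (x : M) : FiniteDimensional ℂ (CTangent n x) :=
  inferInstanceAs (FiniteDimensional ℂ (ℂ ⊗[ℝ] EuclideanSpace ℝ (Fin n)))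

end CKY

/-! ### Linear algebra of a normal form basis at a point -/

namespace CKY

variable {n : ℕ} {M : Type*} [TopologicalSpace M] [ChartedSpace (EuclideanSpace ℝ (Fin n)) M]
  [IsManifold (𝓡 n) ∞ M]

/-- The index type of a normal form basis: `none` for the kernel direction, and the two copies of
`Fin m` for the paired vectors. -/
abbrev NIdx (m : ℕ) : Type := Option (Fin m ⊕ Fin m)

/-- The index of the dual basis vector. -/
def NIdx.flip {m : ℕ} (a : NIdx m) : NIdx m := a.map Sum.swap

theorem NIdx.flip_flip {m : ℕ} (a : NIdx m) : a.flip.flip = a := by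
  rcases a with _ | a <;> simp [NIdx.flip]

/-- A family assembled from a kernel member and the two members of every pair. -/
def nFam {m : ℕ} {A : Type*} (v0 : A) (v w : Fin m → A) (a : NIdx m) : A :=
  a.elim v0 (Sum.elim v w)

/-- The index selected from every pair. -/
def sel {m : ℕ} (s : Fin m → Bool) (i : Fin m) : Fin m ⊕ Fin m := if s i then .inl i else .inr i

theorem nFam_sel {m : ℕ} {A : Type*} (v0 : A) (v w : Fin m → A) (s : Fin m → Bool) (i : Fin m) :
    nFam v0 v w (some (sel s i)) = if s i then v i else w i := by
  unfold nFam sel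
  split <;> rfl

theorem sel_injective {m : ℕ} (s : Fin m → Bool) : Function.Injective (sel s) := by
  intro i j h
  unfold sel at h
  split at h <;> split at h <;> simp_all

/-- A choice never contains both members of a pair. This one combinatorial fact yields both the
isotropy of the chosen span and the non-vanishing of sums of chosen eigenvalues. -/
theorem sel_ne_swap {m : ℕ} (s : Fin m → Bool) (i j : Fin m) : sel s i ≠ (sel s j).swap := by
  intro h
  by_cases hi : s i <;> by_cases hj : s j <;> simp [sel, hi, hj] at h <;> subst h <;> simp_all

namespace IsNormalBasisAt

variable {m : ℕ} {g : PseudoRiemannianMetric n M} {φ : TwoForm n M} {x : M}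
    {lam : Fin m → ℂ} {v0 : CTangent n x} {v w : Fin m → CTangent n x}

theorem g_pair (h : IsNormalBasisAt g φ x lam v0 v w) (a b : NIdx m) :
    g.cForm x (nFam v0 v w a) (nFam v0 v w b) = if b = a.flip then 1 else 0 := by
  have h0v (i : Fin m) : g.cForm x v0 (v i) = 0 := by rw [g.cForm_symm]; exact h.g_v0 i
  have h0w (i : Fin m) : g.cForm x v0 (w i) = 0 := by rw [g.cForm_symm]; exact h.g_w0 i
  have hwv (i j : Fin m) : g.cForm x (w i) (v j) = if i = j then 1 else 0 := by
    rw [g.cForm_symm, ← gC_eq, h.g_vw]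
    simp only [eq_comm]
  have hvv := h.g_vv; have hww := h.g_ww; have hvw := h.g_vw
  have hv0 := h.g_v0; have hw0 := h.g_w0; have h00 := h.g_00
  simp only [gC_eq] at hvv hww hvw hv0 hw0 h00
  rcases a with _ | a | a <;> rcases b with _ | b | b <;>
    simp [nFam, NIdx.flip, h0v, h0w, hwv, hvv, hww, hvw, hv0, hw0, h00, eq_comm]

theorem phi_pair (h : IsNormalBasisAt g φ x lam v0 v w) (a b : NIdx m) :
    φ.cForm x (nFam v0 v w a) (nFam v0 v w b) =
      nFam 0 lam (-lam) a * g.cForm x (nFam v0 v w a) (nFam v0 v w b) := by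
  rw [h.g_pair]
  have h00 : φ.cForm x v0 v0 = 0 := by
    have := φ.cForm_swap x v0 v0
    linear_combination this / 2
  have h0v (i : Fin m) : φ.cForm x v0 (v i) = 0 := by
    rw [φ.cForm_swap, neg_eq_zero]; exact h.phi_v0 i
  have h0w (i : Fin m) : φ.cForm x v0 (w i) = 0 := by
    rw [φ.cForm_swap, neg_eq_zero]; exact h.phi_w0 i
  have hwv (i j : Fin m) : φ.cForm x (w i) (v j) = if i = j then -lam i else 0 := by
    rw [φ.cForm_swap, ← formC_eq, h.phi_vw]
    by_cases hij : i = j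
    · simp [hij]
    · simp [hij, Ne.symm hij]
  have hvv := h.phi_vv; have hww := h.phi_ww; have hvw := h.phi_vw
  have hv0 := h.phi_v0; have hw0 := h.phi_w0
  simp only [formC_eq] at hvv hww hvw hv0 hw0
  rcases a with _ | a | a <;> rcases b with _ | b | b <;>
    simp [nFam, NIdx.flip, h0v, h0w, hwv, hvv, hww, hvw, hv0, hw0, h00, eq_comm]

theorem linearIndependent (h : IsNormalBasisAt g φ x lam v0 v w) :
    LinearIndependent ℂ (nFam v0 v w) := by
  rw [Fintype.linearIndependent_iff]
  intro t ht a
  have := congrArg (fun z ↦ g.cForm x z (nFam v0 v w a.flip)) ht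
  simp only [map_sum, map_smul, LinearMap.sum_apply, LinearMap.smul_apply, h.g_pair,
    LinearMap.zero_apply, map_zero] at this
  rw [Finset.sum_eq_single a] at this
  · simpa using this
  · intro b _ hb
    rw [if_neg, smul_zero]
    intro hc
    exact hb (by rw [← NIdx.flip_flip b, ← hc, NIdx.flip_flip])
  · simp

end IsNormalBasisAt

namespace IsNormalBasisAt

variable {m : ℕ} {M : Type*} [TopologicalSpace M]
  [ChartedSpace (EuclideanSpace ℝ (Fin (2 * m + 1))) M] [IsManifold (𝓡 (2 * m + 1)) ∞ M]
  {g : PseudoRiemannianMetric (2 * m + 1) M} {φ : TwoForm (2 * m + 1) M} {x : M}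
  {lam : Fin m → ℂ} {v0 : CTangent (2 * m + 1) x} {v w : Fin m → CTangent (2 * m + 1) x}

/-- The basis formed by the vectors of a normal form basis. -/
noncomputable def basis (h : IsNormalBasisAt g φ x lam v0 v w) :
    Module.Basis (NIdx m) ℂ (CTangent (2 * m + 1) x) :=
  basisOfLinearIndependentOfCardEqFinrank h.linearIndependent (by
    rw [finrank_cTangent]; simp; ring)

theorem basis_apply (h : IsNormalBasisAt g φ x lam v0 v w) (a : NIdx m) :
    h.basis a = nFam v0 v w a := by
  simp [basis]

/-- The members of a normal form basis are eigenvectors of `φ^♯` with eigenvalues `0`, `λ_i`,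
`-λ_i`. This form of the statement avoids raising indices. -/
theorem phi_eq (h : IsNormalBasisAt g φ x lam v0 v w) (a : NIdx m) (z : CTangent (2 * m + 1) x) :
    φ.cForm x (nFam v0 v w a) z = nFam 0 lam (-lam) a * g.cForm x (nFam v0 v w a) z := by
  have : φ.cForm x (nFam v0 v w a) = nFam 0 lam (-lam) a • g.cForm x (nFam v0 v w a) := by
    refine h.basis.ext fun b ↦ ?_
    rw [h.basis_apply, h.phi_pair]
    rfl
  rw [this]
  rfl

theorem eq_zero (h : IsNormalBasisAt g φ x lam v0 v w) {z : CTangent (2 * m + 1) x}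
    (hz : ∀ a, g.cForm x z (nFam v0 v w a) = 0) : z = 0 := by
  refine g.cForm_nondegenerate fun w ↦ ?_
  have : g.cForm x z = 0 := h.basis.ext fun a ↦ by rw [h.basis_apply, hz]; rfl
  rw [this]
  rfl

theorem coord_eq (h : IsNormalBasisAt g φ x lam v0 v w) (z : CTangent (2 * m + 1) x)
    (a : NIdx m) : h.basis.repr z a = g.cForm x z (nFam v0 v w a.flip) := by
  conv_rhs => rw [← h.basis.sum_repr z]
  simp only [map_sum, map_smul, LinearMap.sum_apply, LinearMap.smul_apply, h.g_pair, h.basis_apply]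
  rw [Finset.sum_eq_single a]
  · simp
  · intro b _ hb
    rw [if_neg, smul_zero]
    intro hc
    exact hb (by rw [← NIdx.flip_flip b, ← hc, NIdx.flip_flip])
  · simp

/-- A counting argument: since the basis diagonalises `φ^♯`, every non-zero eigenvalue occurs in the
list of the `2m` numbers `±λ_i`. There are `2m` such eigenvalues, so the list has no repetition and
no zero. -/
theorem eigenvalues_injective_and_ne_zero (h : IsNormalBasisAt g φ x lam v0 v w)
    (hgen : IsGenericAt m g φ x) :
    Function.Injective (Sum.elim lam (-lam)) ∧ ∀ a, Sum.elim lam (-lam) a ≠ 0 := by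
  set S := {c : ℂ | c ≠ 0 ∧ Module.End.HasEigenvalue ((raise g φ x).baseChange ℂ) c} with hS
  have hsub : S ⊆ Set.range (Sum.elim lam (-lam)) := by
    rintro c ⟨hc, he⟩
    obtain ⟨z, hz⟩ := he.exists_hasEigenvector
    have hz' (b : NIdx m) :
        (c + nFam 0 lam (-lam) b) * g.cForm x z (nFam v0 v w b) = 0 := by
      have h1 := cForm_baseChange_raise g φ x z (nFam v0 v w b)
      rw [hz.apply_eq_smul, map_smul, LinearMap.smul_apply, φ.cForm_swap x (nFam v0 v w b),
        h.phi_eq, g.cForm_symm x _ z, smul_eq_mul] at h1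
      linear_combination h1
    by_contra hcon
    refine hz.2 (h.eq_zero fun b ↦ ?_)
    refine (mul_eq_zero.1 (hz' b)).resolve_left fun h0 ↦ ?_
    rcases b with _ | b | b
    · simp [nFam] at h0; exact hc h0
    · exact hcon ⟨.inr b, by simp [nFam] at h0 ⊢; linear_combination -h0⟩
    · exact hcon ⟨.inl b, by simp [nFam] at h0 ⊢; linear_combination -h0⟩
  have hcard : S.ncard = 2 * m := hgen.1
  have hrange : (Set.range (Sum.elim lam (-lam))).ncard = 2 * m := by
    apply le_antisymm
    · rw [← Set.image_univ]
      refine (Set.ncard_image_le Set.finite_univ).trans ?_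
      rw [Set.ncard_univ]
      simp [two_mul]
    · rw [← hcard]
      exact Set.ncard_le_ncard hsub (Set.finite_range _)
  constructor
  · rw [← Set.injOn_univ]
    refine Set.injOn_of_ncard_image_eq ?_ Set.finite_univ
    rw [Set.image_univ, hrange, Set.ncard_univ]
    simp [two_mul]
  · intro a ha
    -- The inclusion between finite sets of equal size is an equality, so each listed number belongs
    -- to `S` and is in particular non-zero.
    have : S = Set.range (Sum.elim lam (-lam)) :=
      Set.eq_of_subset_of_ncard_le hsub (by rw [hcard, hrange]) (Set.finite_range _)
    have h1 : Sum.elim lam (-lam) a ∈ S := by rw [this]; exact ⟨a, rfl⟩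
    exact h1.1 ha

/-- Were the sum zero, the eigenvalue at `sel s i` would equal the one at the partner of `sel s j`.
By injectivity the indices would agree, which a choice excludes. -/
theorem sel_add_ne_zero (h : IsNormalBasisAt g φ x lam v0 v w) (hgen : IsGenericAt m g φ x)
    (s : Fin m → Bool) (i j : Fin m) :
    Sum.elim lam (-lam) (sel s i) + Sum.elim lam (-lam) (sel s j) ≠ 0 := by
  intro h0
  have hsw : Sum.elim lam (-lam) (sel s j).swap = - Sum.elim lam (-lam) (sel s j) := by
    rcases sel s j with b | b <;> simp
  refine sel_ne_swap s i j ((h.eigenvalues_injective_and_ne_zero hgen).1 ?_)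
  rw [hsw]
  linear_combination h0

end IsNormalBasisAt

/-! ### Vanishing of `dφ` on chosen vectors -/

section Tau

variable {m : ℕ} {g : PseudoRiemannianMetric n M} {φ : TwoForm n M} {x : M}
    {lam : Fin m → ℂ} {v0 : CTangent n x} {v w : Fin m → CTangent n x}

/-- Among three chosen vectors at least two are of the same type. If the third is of the other type,
its index differs from theirs because `s` takes another value there, so the mixed condition applies
after a permutation of the arguments. -/
theorem TauConditionAt.sel_eq_zero (hτ : TauConditionAt m g φ x)
    (h : IsNormalBasisAt g φ x lam v0 v w)
    (h12 : ∀ a b c, φ.extDeriv x b a c = -φ.extDeriv x a b c)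
    (h23 : ∀ a b c, φ.extDeriv x a c b = -φ.extDeriv x a b c) (s : Fin m → Bool)
    (k i j : Fin m) :
    extDerivC φ x (if s k then v k else w k) (if s i then v i else w i)
      (if s j then v j else w j) = 0 := by
  obtain ⟨h1, h2, -⟩ := hτ lam v0 v w h
  have s12 (a b c : CTangent n x) : extDerivC φ x b a c = -extDerivC φ x a b c :=
    cExt₃_swap₁₂ h12 a b c
  have s23 (a b c : CTangent n x) : extDerivC φ x a c b = -extDerivC φ x a b c :=
    cExt₃_swap₂₃ h23 a b c
  have hne {a b : Fin m} (hab : s a ≠ s b) : a ≠ b := fun e ↦ hab (e ▸ rfl)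
  cases hk : s k <;> cases hi : s i <;> cases hj : s j <;>
    simp only [reduceIte, Bool.false_eq_true]
  · exact (h1 k i j).2
  · exact (h2 k i j (hne (by simp [*])) (hne (by simp [*]))).2
  · rw [s23, neg_eq_zero]
    exact (h2 k j i (hne (by simp [*])) (hne (by simp [*]))).2
  · rw [s12, neg_eq_zero, s23, neg_eq_zero]
    exact (h2 i j k (hne (by simp [*])) (hne (by simp [*]))).1
  · rw [s12, neg_eq_zero, s23, neg_eq_zero]
    exact (h2 i j k (hne (by simp [*])) (hne (by simp [*]))).2
  · rw [s23, neg_eq_zero]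
    exact (h2 k j i (hne (by simp [*])) (hne (by simp [*]))).1
  · exact (h2 k i j (hne (by simp [*])) (hne (by simp [*]))).1
  · exact (h1 k i j).1

theorem TauConditionAt.sel_kernel_eq_zero (hτ : TauConditionAt m g φ x)
    (h : IsNormalBasisAt g φ x lam v0 v w)
    (h12 : ∀ a b c, φ.extDeriv x b a c = -φ.extDeriv x a b c) (s : Fin m → Bool)
    (i j : Fin m) :
    extDerivC φ x (if s i then v i else w i) (if s j then v j else w j) v0 = 0 := by
  obtain ⟨-, -, h3⟩ := hτ lam v0 v w h
  have s12 (a b c : CTangent n x) : extDerivC φ x b a c = -extDerivC φ x a b c :=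
    cExt₃_swap₁₂ h12 a b c
  -- The condition on `τ` says nothing about equal indices; there antisymmetry alone gives zero.
  by_cases hij : i = j
  · subst hij
    have := s12 (if s i then v i else w i) (if s i then v i else w i) v0
    linear_combination this / 2
  cases hi : s i <;> cases hj : s j <;> simp only [reduceIte, Bool.false_eq_true]
  · exact (h3 i j hij).2.1
  · rw [s12, neg_eq_zero]
    exact (h3 j i (Ne.symm hij)).2.2
  · exact (h3 i j hij).2.2
  · exact (h3 i j hij).1

end Tau

end CKY

/-! ### Complexified covariant derivative and the conformal Killing–Yano equation -/

namespace CKY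

open Filter Topology

theorem alternatingMap₃_swap₁₂ {T : Type*} [AddCommGroup T] [Module ℝ T] (τ : T [⋀^Fin 3]→ₗ[ℝ] ℝ)
    (a b c : T) : τ ![b, a, c] = -τ ![a, b, c] := by
  rw [← τ.map_swap ![a, b, c] (i := 0) (j := 1) (by decide)]
  congr 1
  ext i
  fin_cases i <;> rfl

theorem alternatingMap₃_swap₂₃ {T : Type*} [AddCommGroup T] [Module ℝ T] (τ : T [⋀^Fin 3]→ₗ[ℝ] ℝ)
    (a b c : T) : τ ![a, c, b] = -τ ![a, b, c] := by
  rw [← τ.map_swap ![a, b, c] (i := 1) (j := 2) (by decide)]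
  congr 1
  ext i
  fin_cases i <;> rfl

variable {n : ℕ} {M : Type*} [TopologicalSpace M] [ChartedSpace (EuclideanSpace ℝ (Fin n)) M]
  [IsManifold (𝓡 n) ∞ M]

theorem leviCivita_sub (g : PseudoRiemannianMetric n M) {X Y : Π x : M, TangentSpace (𝓡 n) x}
    {x : M} (hX : DiffAt X x) (hY : DiffAt Y x) :
    VectorField.mlieBracket (𝓡 n) X Y x = g.leviCivita Y x (X x) - g.leviCivita X x (Y x) :=
  ((g.leviCivita.torsion_eq_zero_iff).1 g.leviCivita_spec.1 hX hY).symm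

theorem mvfderiv_form (g : PseudoRiemannianMetric n M) (φ : TwoForm n M) (x : M)
    (u : TangentSpace (𝓡 n) x) (Y Z : Π x : M, TangentSpace (𝓡 n) x) :
    mvfderiv (𝓡 n) (fun y ↦ φ.form y (Y y) (Z y)) x u = covDeriv g φ x u Y Z
      + φ.form x (g.leviCivita Y x u) (Z x) + φ.form x (Y x) (g.leviCivita Z x u) := by
  simp only [covDeriv]
  ring

/-- The 3-form of the conformal Killing-Yano equation is the exterior derivative. -/
theorem extDeriv_eq {g : PseudoRiemannianMetric n M} {φ : TwoForm n M}
    {τ : Π x : M, TangentSpace (𝓡 n) x [⋀^Fin 3]→ₗ[ℝ] ℝ}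
    {K : Π x : M, Module.Dual ℝ (TangentSpace (𝓡 n) x)}
    (h : ∀ (x : M) (u : TangentSpace (𝓡 n) x) (Y Z : Π x : M, TangentSpace (𝓡 n) x),
      DiffAt Y x → DiffAt Z x →
      covDeriv g φ x u Y Z = 1 / 3 * τ x ![u, Y x, Z x]
        + 1 / ((n : ℝ) - 1) * (g.form x u (Y x) * K x (Z x) - g.form x u (Z x) * K x (Y x)))
    (x : M) (u v w : TangentSpace (𝓡 n) x) : φ.extDeriv x u v w = τ x ![u, v, w] := by
  have hX := PseudoRiemannianMetric.diffAt_extend u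
  have hY := PseudoRiemannianMetric.diffAt_extend v
  have hZ := PseudoRiemannianMetric.diffAt_extend w
  simp only [TwoForm.extDeriv, mvfderiv_form g, leviCivita_sub g hX hY, leviCivita_sub g hX hZ,
    leviCivita_sub g hY hZ, h x _ _ _ hX hY, h x _ _ _ hX hZ, h x _ _ _ hY hZ,
    FiberBundle.extend_apply_self, map_sub, _root_.sub_apply]
  -- The connection terms cancel against the brackets, since the torsion is zero. Once all arguments
  -- are in the same order, the three terms `τ/3` add up to `τ`, and the `K`-terms cancel by
  -- symmetry of `g`.
  rw [alternatingMap₃_swap₁₂ (τ x) u v w, alternatingMap₃_swap₁₂ (τ x) u w v,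
    alternatingMap₃_swap₂₃ (τ x) u v w, g.symm x v u, g.symm x w u, g.symm x w v]
  simp only [φ.form_swap x u, φ.form_swap x v, φ.form_swap x w]
  ring

/-- The (rough) complex vector field `Z` is differentiable at `x`. -/
def CDiffAt (Z : Π x : M, CTangent n x) (x : M) : Prop :=
  DiffAt (fun y ↦ rePart (Z y)) x ∧ DiffAt (fun y ↦ imPart (Z y)) x

theorem SmoothFieldOn.cDiffAt {Z : Π x : M, CTangent n x} {U : Set M} (h : SmoothFieldOn Z U)
    (hU : IsOpen U) {x : M} (hx : x ∈ U) : CDiffAt Z x :=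
  ⟨(h.1.contMDiffAt (hU.mem_nhds hx)).mdifferentiableAt (by simp),
    (h.2.contMDiffAt (hU.mem_nhds hx)).mdifferentiableAt (by simp)⟩

/-- The covariant derivative of a complex vector field in a real direction. -/
noncomputable def covR (g : PseudoRiemannianMetric n M) (x : M) (u : TangentSpace (𝓡 n) x)
    (Z : Π x : M, CTangent n x) : CTangent n x :=
  ofParts (g.leviCivita (fun y ↦ rePart (Z y)) x u) (g.leviCivita (fun y ↦ imPart (Z y)) x u)

/-- The covariant derivative of a complex vector field in a complex direction. -/
noncomputable def covC (g : PseudoRiemannianMetric n M) (x : M) (a : CTangent n x)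
    (Z : Π x : M, CTangent n x) : CTangent n x :=
  covR g x (rePart a) Z + Complex.I • covR g x (imPart a) Z

theorem covC_add (g : PseudoRiemannianMetric n M) (x : M) (a b : CTangent n x)
    (Z : Π x : M, CTangent n x) : covC g x (a + b) Z = covC g x a Z + covC g x b Z := by
  simp only [covC, covR, ofParts, map_add, TensorProduct.tmul_add, smul_add]
  abel

theorem covC_smul (g : PseudoRiemannianMetric n M) (x : M) (c : ℂ) (a : CTangent n x)
    (Z : Π x : M, CTangent n x) : covC g x (c • a) Z = c • covC g x a Z := by
  apply ext_parts
  · simp only [covC, covR, rePart_smul, imPart_smul, map_add, map_sub, map_smul, rePart_ofParts,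
      imPart_ofParts, Complex.I_re, Complex.I_im]
    module
  · simp only [covC, covR, rePart_smul, imPart_smul, map_add, map_sub, map_smul, rePart_ofParts,
      imPart_ofParts, Complex.I_re, Complex.I_im]
    module

/-- The absence of torsion, extended complex-bilinearly from the four pairs of real and imaginary
parts. -/
theorem lieBracketC_eq (g : PseudoRiemannianMetric n M) {A B : Π x : M, CTangent n x} {x : M}
    (hA : CDiffAt A x) (hB : CDiffAt B x) :
    lieBracketC A B x = covC g x (A x) B - covC g x (B x) A := by
  rw [lieBracketC, leviCivita_sub g hA.1 hB.1, leviCivita_sub g hA.2 hB.2,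
    leviCivita_sub g hA.1 hB.2, leviCivita_sub g hA.2 hB.1]
  apply ext_parts
  · simp only [covC, covR, rePart_smul, map_add, map_sub, rePart_ofParts,
      imPart_ofParts, Complex.I_re, Complex.I_im]
    module
  · simp only [covC, covR, imPart_smul, map_add, map_sub, rePart_ofParts,
      imPart_ofParts, Complex.I_re, Complex.I_im]
    module

theorem mvfderiv_eq_zero_of_eventuallyEq {f : M → ℝ} {x : M} {c : ℝ}
    (h : f =ᶠ[𝓝 x] fun _ ↦ c) (u : TangentSpace (𝓡 n) x) : mvfderiv (𝓡 n) f x u = 0 := by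
  have h1 : mfderiv (𝓡 n) 𝓘(ℝ, ℝ) f x = mfderiv (𝓡 n) 𝓘(ℝ, ℝ) (fun _ : M ↦ c) x := h.mfderiv_eq
  have h2 : mvfderiv (𝓡 n) f x u = mvfderiv (𝓡 n) (fun _ : M ↦ c) x u :=
    congrArg (fun L : EuclideanSpace ℝ (Fin n) →L[ℝ] ℝ ↦ L u) h1
  rw [h2, mvfderiv_const]
  rfl

/-- Here `q u` stands for `∇_u t` as a function of the values of the fields at `x`: zero for the
metric, the right-hand side of the conformal Killing–Yano equation for `φ`. One product rule thus
serves both tensors. The real and imaginary parts of the locally constant function are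
differentiated separately. -/
theorem Tensor2.deriv_const_real (t : Tensor2 n M) (g : PseudoRiemannianMetric n M) {x : M}
    {A B : Π x : M, CTangent n x} (hA : CDiffAt A x) (hB : CDiffAt B x) {c : ℂ}
    (hc : ∀ᶠ y in 𝓝 x, t.cForm y (A y) (B y) = c)
    {q : TangentSpace (𝓡 n) x → TangentSpace (𝓡 n) x → TangentSpace (𝓡 n) x → ℝ}
    (hq : ∀ (u : TangentSpace (𝓡 n) x) (Y Z : Π x : M, TangentSpace (𝓡 n) x),
      DiffAt Y x → DiffAt Z x →
      mvfderiv (𝓡 n) (fun y ↦ t.form y (Y y) (Z y)) x u = q u (Y x) (Z x)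
        + t.form x (g.leviCivita Y x u) (Z x) + t.form x (Y x) (g.leviCivita Z x u))
    (u : TangentSpace (𝓡 n) x) :
    cExt₂ (q u) (A x) (B x) + t.cForm x (covR g x u A) (B x)
      + t.cForm x (A x) (covR g x u B) = 0 := by
  have hre : (fun y ↦ t.form y (rePart (A y)) (rePart (B y)) -
      t.form y (imPart (A y)) (imPart (B y))) =ᶠ[𝓝 x] fun _ ↦ c.re := by
    filter_upwards [hc] with y hy
    have := congrArg Complex.re hy
    simpa [Tensor2.cForm_apply, cExt₂, cExt, sub_eq_add_neg] using this
  have him : (fun y ↦ t.form y (rePart (A y)) (imPart (B y)) +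
      t.form y (imPart (A y)) (rePart (B y))) =ᶠ[𝓝 x] fun _ ↦ c.im := by
    filter_upwards [hc] with y hy
    have := congrArg Complex.im hy
    simpa [Tensor2.cForm_apply, cExt₂, cExt] using this
  have h1 := mvfderiv_eq_zero_of_eventuallyEq hre u
  have h2 := mvfderiv_eq_zero_of_eventuallyEq him u
  have e1 := congr($(mvfderiv_fun_sub (t.mdiff hA.1 hB.1) (t.mdiff hA.2 hB.2)) u)
  have e2 := congr($(mvfderiv_fun_add (t.mdiff hA.1 hB.2) (t.mdiff hA.2 hB.1)) u)
  rw [h1, _root_.sub_apply, hq u _ _ hA.1 hB.1, hq u _ _ hA.2 hB.2] at e1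
  rw [h2, _root_.add_apply, hq u _ _ hA.1 hB.2, hq u _ _ hA.2 hB.1] at e2
  simp only [Tensor2.cForm_apply, cExt₂, cExt, covR, rePart_ofParts, imPart_ofParts]
  apply Complex.ext
  · simp
    linarith
  · simp
    linarith

theorem Tensor2.deriv_const (t : Tensor2 n M) (g : PseudoRiemannianMetric n M) {x : M}
    {A B : Π x : M, CTangent n x} (hA : CDiffAt A x) (hB : CDiffAt B x) {c : ℂ}
    (hc : ∀ᶠ y in 𝓝 x, t.cForm y (A y) (B y) = c)
    {q : TangentSpace (𝓡 n) x → TangentSpace (𝓡 n) x → TangentSpace (𝓡 n) x → ℝ}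
    (hq : ∀ (u : TangentSpace (𝓡 n) x) (Y Z : Π x : M, TangentSpace (𝓡 n) x),
      DiffAt Y x → DiffAt Z x →
      mvfderiv (𝓡 n) (fun y ↦ t.form y (Y y) (Z y)) x u = q u (Y x) (Z x)
        + t.form x (g.leviCivita Y x u) (Z x) + t.form x (Y x) (g.leviCivita Z x u))
    (a : CTangent n x) :
    cExt₃ q a (A x) (B x) + t.cForm x (covC g x a A) (B x)
      + t.cForm x (A x) (covC g x a B) = 0 := by
  have h1 := t.deriv_const_real g hA hB hc hq (rePart a)
  have h2 := t.deriv_const_real g hA hB hc hq (imPart a)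
  simp only [covC, cExt₃, cExt, map_add, map_smul, LinearMap.add_apply, LinearMap.smul_apply,
    smul_eq_mul]
  linear_combination h1 + Complex.I * h2

/-- The connection is compatible with the complexified metric. -/
theorem gC_covC_eq_zero (g : PseudoRiemannianMetric n M) {x : M}
    {A B : Π x : M, CTangent n x} (hA : CDiffAt A x) (hB : CDiffAt B x) {c : ℂ}
    (hc : ∀ᶠ y in 𝓝 x, g.cForm y (A y) (B y) = c) (a : CTangent n x) :
    g.cForm x (covC g x a A) (B x) + g.cForm x (A x) (covC g x a B) = 0 := by
  have := g.toTensor2.deriv_const g hA hB hc (q := fun _ _ _ ↦ 0) (fun u Y Z hY hZ ↦ by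
    rw [zero_add]; exact g.leviCivita_spec.2 x Y Z u hY hZ) a
  simpa [cExt₃, cExt₂, cExt] using this

/-- The conformal Killing-Yano equation on complex vector fields. -/
theorem formC_covC_eq_zero {g : PseudoRiemannianMetric n M} {φ : TwoForm n M}
    (hφ : IsConformalKillingYano g φ) {x : M}
    {A B : Π x : M, CTangent n x} (hA : CDiffAt A x) (hB : CDiffAt B x) {c : ℂ}
    (hc : ∀ᶠ y in 𝓝 x, φ.cForm y (A y) (B y) = c) {a : CTangent n x}
    (haA : g.cForm x a (A x) = 0) (haB : g.cForm x a (B x) = 0) :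
    1 / 3 * extDerivC φ x a (A x) (B x) + φ.cForm x (covC g x a A) (B x)
      + φ.cForm x (A x) (covC g x a B) = 0 := by
  obtain ⟨τ, K, h⟩ := hφ
  have key := φ.toTensor2.deriv_const g hA hB hc (q := fun u y z ↦ 1 / 3 * φ.extDeriv x u y z
      + 1 / ((n : ℝ) - 1) * (g.form x u y * K x z - g.form x u z * K x y))
    (fun u Y Z hY hZ ↦ by rw [extDeriv_eq h, ← h x u Y Z hY hZ]; exact mvfderiv_form g φ x u Y Z) a
  have e : cExt₃ (fun u y z ↦ 1 / 3 * φ.extDeriv x u y z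
      + 1 / ((n : ℝ) - 1) * (g.form x u y * K x z - g.form x u z * K x y)) a (A x) (B x) =
      1 / 3 * extDerivC φ x a (A x) (B x) + 1 / ((n : ℂ) - 1) *
        (g.cForm x a (A x) * cExt (fun b ↦ (K x b : ℂ)) (B x)
          - g.cForm x a (B x) * cExt (fun b ↦ (K x b : ℂ)) (A x)) := by
    simp only [extDerivC, cExt₃, cExt₂, cExt, Tensor2.cForm_apply]
    push_cast
    ring
  -- The unknown 1-form `K` enters only through the factors `g(a, A)` and `g(a, B)`, which is why
  -- orthogonality of the direction to both fields eliminates it.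
  rw [e, haA, haB] at key
  linear_combination key

theorem extDeriv_swap₁₂ {g : PseudoRiemannianMetric n M} {φ : TwoForm n M}
    (hφ : IsConformalKillingYano g φ) (x : M) (a b c : TangentSpace (𝓡 n) x) :
    φ.extDeriv x b a c = -φ.extDeriv x a b c := by
  obtain ⟨τ, K, h⟩ := hφ
  rw [extDeriv_eq h, extDeriv_eq h, alternatingMap₃_swap₁₂]

theorem extDeriv_swap₂₃ {g : PseudoRiemannianMetric n M} {φ : TwoForm n M}
    (hφ : IsConformalKillingYano g φ) (x : M) (a b c : TangentSpace (𝓡 n) x) :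
    φ.extDeriv x a c b = -φ.extDeriv x a b c := by
  obtain ⟨τ, K, h⟩ := hφ
  rw [extDeriv_eq h, extDeriv_eq h, alternatingMap₃_swap₂₃]

end CKY

/-! ### Orthogonality of brackets, and intersection with the conjugate -/

namespace CKY

open Filter Topology

theorem eq_zero_of_mem_span {E : Type*} [AddCommGroup E] [Module ℂ E] {S : Set E}
    (f : E →ₗ[ℂ] E →ₗ[ℂ] ℂ) (h : ∀ a ∈ S, ∀ b ∈ S, f a b = 0) {a b : E}
    (ha : a ∈ Submodule.span ℂ S) (hb : b ∈ Submodule.span ℂ S) : f a b = 0 := by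
  have h1 : ∀ a ∈ S, f a b = 0 := fun a ha ↦
    (Submodule.span_le (p := LinearMap.ker (f a))).2 (fun b hb ↦ h a ha b hb) hb
  exact (Submodule.span_le (p := LinearMap.ker (f.flip b))).2 (fun a ha ↦ h1 a ha) ha

section
variable {n : ℕ} {M : Type*} [TopologicalSpace M] [ChartedSpace (EuclideanSpace ℝ (Fin n)) M]
  [IsManifold (𝓡 n) ∞ M]

/-- The covariant derivative of a complex field as a linear map in the direction. -/
noncomputable def covL (g : PseudoRiemannianMetric n M) (x : M) (Z : Π x : M, CTangent n x) :
    CTangent n x →ₗ[ℂ] CTangent n x where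
  toFun a := covC g x a Z
  map_add' a b := covC_add g x a b Z
  map_smul' c a := covC_smul g x c a Z

/-- Metric compatibility moves the derivative from `A` and `B` onto `Z`. Afterwards `A` and `B`
enter only through their values at `x`. -/
theorem gC_lieBracketC_eq (g : PseudoRiemannianMetric n M) {x : M} {A B Z : Π x : M, CTangent n x}
    (hA : CDiffAt A x) (hB : CDiffAt B x) (hZ : CDiffAt Z x)
    (hAZ : ∀ᶠ y in 𝓝 x, g.cForm y (A y) (Z y) = 0)
    (hBZ : ∀ᶠ y in 𝓝 x, g.cForm y (B y) (Z y) = 0) :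
    g.cForm x (lieBracketC A B x) (Z x) =
      g.cForm x (A x) (covC g x (B x) Z) - g.cForm x (B x) (covC g x (A x) Z) := by
  rw [lieBracketC_eq g hA hB, map_sub, LinearMap.sub_apply]
  linear_combination gC_covC_eq_zero g hB hZ hBZ (A x) - gC_covC_eq_zero g hA hZ hAZ (B x)

/-- If the antisymmetrised second fundamental form in the direction of the field `Z` vanishes on
generators of a distribution orthogonal to `Z`, brackets of sections remain orthogonal to `Z`. -/
theorem gC_lieBracketC_eq_zero (g : PseudoRiemannianMetric n M) {x : M}
    {A B Z : Π x : M, CTangent n x} {S : Set (CTangent n x)}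
    (hA : CDiffAt A x) (hB : CDiffAt B x) (hZ : CDiffAt Z x)
    (hAZ : ∀ᶠ y in 𝓝 x, g.cForm y (A y) (Z y) = 0)
    (hBZ : ∀ᶠ y in 𝓝 x, g.cForm y (B y) (Z y) = 0)
    (hAS : A x ∈ Submodule.span ℂ S) (hBS : B x ∈ Submodule.span ℂ S)
    (hS : ∀ a ∈ S, ∀ b ∈ S, g.cForm x a (covC g x b Z) = g.cForm x b (covC g x a Z)) :
    g.cForm x (lieBracketC A B x) (Z x) = 0 := by
  rw [gC_lieBracketC_eq g hA hB hZ hAZ hBZ]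
  -- The form `(a, b) ↦ g(a, ∇_b Z) - g(b, ∇_a Z)` is complex-bilinear, so vanishing on generators
  -- suffices.
  exact eq_zero_of_mem_span
    ((g.cForm x).compl₂ (covL g x Z) - ((g.cForm x).compl₂ (covL g x Z)).flip)
    (fun a ha b hb ↦ sub_eq_zero.2 (hS a ha b hb)) hAS hBS

/-- For `z` in the intersection, `conj z` also lies in the isotropic space `D`, so `0 = g(z, conj z)
= g(Re z, Re z) + g(Im z, Im z)`, and definiteness gives `z = 0`. -/
theorem inf_conjSubspace_eq_bot {g : PseudoRiemannianMetric n M} (hg : g.IsRiemannian) {x : M}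
    {D : Submodule ℂ (CTangent n x)} (hD : ∀ z ∈ D, ∀ w ∈ D, g.cForm x z w = 0) :
    D ⊓ conjSubspace D = ⊥ := by
  rw [eq_bot_iff]
  rintro z ⟨h1, h2⟩
  have h := hD z h1 _ (conjVec_mem_of_mem_conjSubspace h2)
  simp only [Tensor2.cForm_apply, cExt₂, cExt, rePart_conjVec, imPart_conjVec] at h
  have h' := congrArg Complex.re h
  simp at h'
  have nonneg (u : TangentSpace (𝓡 n) x) : 0 ≤ g.form x u u := by
    rcases eq_or_ne u 0 with rfl | hu
    · simp
    · exact (hg x u hu).le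
  have hr := nonneg (rePart z)
  have hi := nonneg (imPart z)
  refine ext_parts ?_ ?_
  · by_contra hne
    have := hg x (rePart z) (by simpa using hne)
    linarith
  · by_contra hne
    have := hg x (imPart z) (by simpa using hne)
    linarith

end

/-! ### The chosen subspaces as orthogonal complements -/

namespace IsNormalBasisAt

variable {m : ℕ} {M : Type*} [TopologicalSpace M]
  [ChartedSpace (EuclideanSpace ℝ (Fin (2 * m + 1))) M] [IsManifold (𝓡 (2 * m + 1)) ∞ M]
  {g : PseudoRiemannianMetric (2 * m + 1) M} {φ : TwoForm (2 * m + 1) M} {x : M}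
  {lam : Fin m → ℂ} {v0 : CTangent (2 * m + 1) x} {v w : Fin m → CTangent (2 * m + 1) x}

/-- The coefficient of `z` at a basis vector is its product with the partner vector. It therefore
suffices that each basis vector either lies in `P` or has coefficient zero. -/
theorem mem_of_forall (h : IsNormalBasisAt g φ x lam v0 v w)
    {P : Submodule ℂ (CTangent (2 * m + 1) x)} {z : CTangent (2 * m + 1) x}
    (hz : ∀ a, nFam v0 v w a ∈ P ∨ g.cForm x z (nFam v0 v w a.flip) = 0) : z ∈ P := by
  rw [← h.basis.sum_repr z]
  refine Submodule.sum_mem _ fun a _ ↦ ?_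
  rw [h.coord_eq, h.basis_apply]
  rcases hz a with ha | ha
  · exact P.smul_mem _ ha
  · rw [ha, zero_smul]
    exact P.zero_mem

theorem sel_or_swap_sel (s : Fin m → Bool) (b : Fin m ⊕ Fin m) :
    (∃ i, b = sel s i) ∨ ∃ i, b.swap = sel s i := by
  rcases b with i | i <;> by_cases hs : s i
  · exact .inl ⟨i, by simp [sel, hs]⟩
  · exact .inr ⟨i, by simp [sel, hs]⟩
  · exact .inr ⟨i, by simp [sel, hs]⟩
  · exact .inl ⟨i, by simp [sel, hs]⟩

/-- This is `(D ⊕ ⟨V_0⟩)^⊥ ⊆ D`: it turns the membership of a bracket in `D` into finitely many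
orthogonality relations. -/
theorem mem_span_sel (h : IsNormalBasisAt g φ x lam v0 v w) (s : Fin m → Bool)
    {z : CTangent (2 * m + 1) x}
    (hz : ∀ k, g.cForm x z (if s k then v k else w k) = 0) (hz0 : g.cForm x z v0 = 0) :
    z ∈ Submodule.span ℂ (Set.range fun i ↦ if s i then v i else w i) := by
  refine h.mem_of_forall fun a ↦ ?_
  rcases a with _ | b
  · exact .inr hz0
  · rcases sel_or_swap_sel s b with ⟨i, rfl⟩ | ⟨i, hi⟩
    · exact .inl (Submodule.subset_span ⟨i, (nFam_sel v0 v w s i).symm⟩)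
    · refine .inr ?_
      change g.cForm x z (nFam v0 v w (some b.swap)) = 0
      rw [hi, nFam_sel]
      exact hz i

/-- This is `D^⊥ ⊆ D ⊕ ⟨V_0⟩`; orthogonality to `V_0` is no longer required. -/
theorem mem_span_sel_sup (h : IsNormalBasisAt g φ x lam v0 v w) (s : Fin m → Bool)
    {z : CTangent (2 * m + 1) x}
    (hz : ∀ k, g.cForm x z (if s k then v k else w k) = 0) :
    z ∈ Submodule.span ℂ (Set.range fun i ↦ if s i then v i else w i) ⊔ Submodule.span ℂ {v0} := by
  refine h.mem_of_forall fun a ↦ ?_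
  rcases a with _ | b
  · exact .inl (Submodule.mem_sup_right (Submodule.mem_span_singleton_self v0))
  · rcases sel_or_swap_sel s b with ⟨i, rfl⟩ | ⟨i, hi⟩
    · exact .inl (Submodule.mem_sup_left
        (Submodule.subset_span ⟨i, (nFam_sel v0 v w s i).symm⟩))
    · refine .inr ?_
      change g.cForm x z (nFam v0 v w (some b.swap)) = 0
      rw [hi, nFam_sel]
      exact hz i

theorem g_sel_sel (h : IsNormalBasisAt g φ x lam v0 v w) (s : Fin m → Bool) (i j : Fin m) :
    g.cForm x (if s i then v i else w i) (if s j then v j else w j) = 0 := by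
  rw [← nFam_sel v0, ← nFam_sel v0, h.g_pair, if_neg]
  intro he
  exact sel_ne_swap s j i (Option.some_injective _ he)

theorem g_sel_kernel (h : IsNormalBasisAt g φ x lam v0 v w) (s : Fin m → Bool) (i : Fin m) :
    g.cForm x (if s i then v i else w i) v0 = 0 := by
  split
  · exact h.g_v0 i
  · exact h.g_w0 i

theorem g_kernel_sel (h : IsNormalBasisAt g φ x lam v0 v w) (s : Fin m → Bool) (i : Fin m) :
    g.cForm x v0 (if s i then v i else w i) = 0 := by
  rw [g.cForm_symm]
  exact h.g_sel_kernel s i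

theorem phi_sel (h : IsNormalBasisAt g φ x lam v0 v w) (s : Fin m → Bool) (i : Fin m)
    (z : CTangent (2 * m + 1) x) :
    φ.cForm x (if s i then v i else w i) z =
      Sum.elim lam (-lam) (sel s i) * g.cForm x (if s i then v i else w i) z := by
  rw [← nFam_sel v0, h.phi_eq]
  rfl

theorem phi_kernel (h : IsNormalBasisAt g φ x lam v0 v w) (z : CTangent (2 * m + 1) x) :
    φ.cForm x v0 z = 0 := by
  have := h.phi_eq none z
  simpa [nFam] using this

theorem linearIndependent_sel (h : IsNormalBasisAt g φ x lam v0 v w) (s : Fin m → Bool) :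
    LinearIndependent ℂ fun i ↦ if s i then v i else w i := by
  have := h.linearIndependent.comp (fun i ↦ some (sel s i))
    ((Option.some_injective _).comp (sel_injective s))
  simpa only [Function.comp_def, nFam_sel] using this

theorem linearIndependent_cons_sel (h : IsNormalBasisAt g φ x lam v0 v w) (s : Fin m → Bool) :
    LinearIndependent ℂ (Fin.cons v0 fun i ↦ if s i then v i else w i :
      Fin (m + 1) → CTangent (2 * m + 1) x) := by
  have := h.linearIndependent.comp (Fin.cons none fun i ↦ some (sel s i)) (by
    rw [Fin.cons_injective_iff]
    exact ⟨by simp, (Option.some_injective _).comp (sel_injective s)⟩)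
  convert this using 1
  funext i
  refine Fin.cases ?_ (fun i ↦ ?_) i
  · rfl
  · simp only [Fin.cons_succ, Function.comp_apply, nFam_sel]

/-- Where two choices differ, the chosen vectors are partners with product `1`. If the spans agreed,
both vectors would lie in one isotropic space. -/
theorem span_sel_injective (h : IsNormalBasisAt g φ x lam v0 v w) :
    Function.Injective fun s : Fin m → Bool ↦
      Submodule.span ℂ (Set.range fun i ↦ if s i then v i else w i) := by
  intro s s' hss
  funext i
  by_contra hne
  have h1 : (if s i then v i else w i) ∈
      Submodule.span ℂ (Set.range fun i ↦ if s' i then v i else w i) := by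
    rw [← show _ = Submodule.span ℂ (Set.range fun i ↦ if s' i then v i else w i) from hss]
    exact Submodule.subset_span ⟨i, rfl⟩
  have h2 : g.cForm x (if s i then v i else w i) (if s' i then v i else w i) = 0 :=
    (Submodule.span_le (p := LinearMap.ker ((g.cForm x).flip (if s' i then v i else w i)))).2
      (by rintro _ ⟨j, rfl⟩; exact h.g_sel_sel s' j i) h1
  rw [← nFam_sel v0, ← nFam_sel v0, h.g_pair, if_pos] at h2
  · exact one_ne_zero h2
  · cases hs : s i <;> cases hs' : s' i <;> simp_all [sel, NIdx.flip]

theorem sel_ne_zero (h : IsNormalBasisAt g φ x lam v0 v w) (hgen : IsGenericAt m g φ x)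
    (s : Fin m → Bool) (i : Fin m) : Sum.elim lam (-lam) (sel s i) ≠ 0 :=
  (h.eigenvalues_injective_and_ne_zero hgen).2 _

theorem isMaximalIsotropic_span_sel (h : IsNormalBasisAt g φ x lam v0 v w)
    (hgen : IsGenericAt m g φ x) (s : Fin m → Bool) :
    IsMaximalIsotropic m g φ x
      (Submodule.span ℂ (Set.range fun i ↦ if s i then v i else w i)) := by
  refine ⟨?_, fun z hz w hw ↦ eq_zero_of_mem_span (g.cForm x) ?_ hz hw, fun z hz k hk ↦ ?_⟩
  · rw [finrank_span_eq_card (h.linearIndependent_sel s), Fintype.card_fin]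
  · rintro _ ⟨i, rfl⟩ _ ⟨j, rfl⟩
    exact h.g_sel_sel s i j
  · refine (Submodule.span_le (p := LinearMap.ker ((g.cForm x).flip (1 ⊗ₜ[ℝ] k)))).2 ?_ hz
    rintro _ ⟨i, rfl⟩
    -- For `k` in the kernel, `0 = φ(k, X_i) = -c_i g(X_i, k)` with `c_i ≠ 0`.
    have h1 := cForm_baseChange_raise g φ x (1 ⊗ₜ[ℝ] k) (if s i then v i else w i)
    rw [LinearMap.baseChange_tmul, LinearMap.mem_ker.1 hk, TensorProduct.tmul_zero, map_zero,
      LinearMap.zero_apply, φ.cForm_swap x (if s i then v i else w i), h.phi_sel] at h1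
    exact (mul_eq_zero.1 (neg_eq_zero.1 h1.symm)).resolve_left (h.sel_ne_zero hgen s i)

end IsNormalBasisAt

/-! ### Covariant derivatives of a normal form frame, and integrability -/

namespace IsNormalFrameOn

variable {m : ℕ} {M : Type*} [TopologicalSpace M]
  [ChartedSpace (EuclideanSpace ℝ (Fin (2 * m + 1))) M] [IsManifold (𝓡 (2 * m + 1)) ∞ M]
  {g : PseudoRiemannianMetric (2 * m + 1) M} {φ : TwoForm (2 * m + 1) M} {U : Set M}
  {lam : Fin m → M → ℂ} {V0 : Π x : M, CTangent (2 * m + 1) x}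
  {V W : Fin m → Π x : M, CTangent (2 * m + 1) x}

/-- The field selected from the `i`-th pair. -/
noncomputable def selField (V W : Fin m → Π x : M, CTangent (2 * m + 1) x) (s : Fin m → Bool) (i : Fin m)
    (x : M) : CTangent (2 * m + 1) x := if s i then V i x else W i x

theorem smooth_selField (h : IsNormalFrameOn g φ U lam V0 V W) (s : Fin m → Bool) (i : Fin m) :
    SmoothFieldOn (selField V W s i) U := by
  unfold selField
  by_cases hs : s i
  · simp only [hs, if_true]
    exact h.smooth_V i
  · simp only [hs]
    exact h.smooth_W i

theorem eventually_g_sel_sel (h : IsNormalFrameOn g φ U lam V0 V W) (hU : IsOpen U)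
    (s : Fin m → Bool) (i j : Fin m) {x : M} (hx : x ∈ U) :
    ∀ᶠ y in 𝓝 x, g.cForm y (selField V W s i y) (selField V W s j y) = 0 := by
  filter_upwards [hU.mem_nhds hx] with y hy
  exact (h.normal y hy).g_sel_sel s i j

theorem eventually_g_sel_kernel (h : IsNormalFrameOn g φ U lam V0 V W) (hU : IsOpen U)
    (s : Fin m → Bool) (i : Fin m) {x : M} (hx : x ∈ U) :
    ∀ᶠ y in 𝓝 x, g.cForm y (selField V W s i y) (V0 y) = 0 := by
  filter_upwards [hU.mem_nhds hx] with y hy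
  exact (h.normal y hy).g_sel_kernel s i

/-- Covariant derivatives of two selected fields along a null direction on which `dφ` vanishes. -/
theorem g_covC_sel_sel (h : IsNormalFrameOn g φ U lam V0 V W) (hU : IsOpen U)
    (hφ : IsConformalKillingYano g φ) (s : Fin m → Bool) {x : M} (hx : x ∈ U)
    (hgen : IsGenericAt m g φ x) (i j : Fin m) {a : CTangent (2 * m + 1) x}
    (hai : g.cForm x a (selField V W s i x) = 0) (haj : g.cForm x a (selField V W s j x) = 0)
    (hτ : extDerivC φ x a (selField V W s i x) (selField V W s j x) = 0) :
    g.cForm x (covC g x a (selField V W s i)) (selField V W s j x) = 0 := by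
  have hi := (h.smooth_selField s i).cDiffAt hU hx
  have hj := (h.smooth_selField s j).cDiffAt hU hx
  have h1 := gC_covC_eq_zero g hi hj (h.eventually_g_sel_sel hU s i j hx) a
  -- The function `φ(X_i, X_j) = c_i g(X_i, X_j)` vanishes identically near `x`, so no derivative of
  -- the eigenvalue functions ever appears.
  have h2 := formC_covC_eq_zero hφ hi hj (c := 0) (by
    filter_upwards [h.eventually_g_sel_sel hU s i j hx, hU.mem_nhds hx] with y hy hyU
    exact ((h.normal y hyU).phi_sel s i _).trans (by rw [← selField, hy, mul_zero])) hai haj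
  have e1 := (h.normal x hx).phi_sel s i (covC g x a (selField V W s j))
  have e2 := (h.normal x hx).phi_sel s j (covC g x a (selField V W s i))
  rw [← selField] at e1 e2
  rw [hτ, e1, φ.cForm_swap x (selField V W s j x), e2,
    g.cForm_symm x (selField V W s j x)] at h2
  refine (mul_eq_zero.1 ?_).resolve_left ((h.normal x hx).sel_add_ne_zero hgen s i j)
  -- Here `h2` reads `-c_j g(∇_a X_i, X_j) + c_i g(X_i, ∇_a X_j) = 0`, and `h1` replaces `g(X_i, ∇_a
  -- X_j)` by `-g(∇_a X_i, X_j)`.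
  linear_combination Sum.elim (fun i ↦ lam i x) (-fun i ↦ lam i x) (sel s i) * h1 - h2

/-- Differentiating `φ(X_i, V_0) = 0` suffices: the term `φ(∇_a X_i, V_0)` is zero because `V_0`
spans the kernel, and the other one is `c_i g(X_i, ∇_a V_0)` with `c_i ≠ 0`. -/
theorem g_covC_sel_kernel (h : IsNormalFrameOn g φ U lam V0 V W) (hU : IsOpen U)
    (hφ : IsConformalKillingYano g φ) (s : Fin m → Bool) {x : M} (hx : x ∈ U)
    (hgen : IsGenericAt m g φ x) (i : Fin m) {a : CTangent (2 * m + 1) x}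
    (hai : g.cForm x a (selField V W s i x) = 0) (ha0 : g.cForm x a (V0 x) = 0)
    (hτ : extDerivC φ x a (selField V W s i x) (V0 x) = 0) :
    g.cForm x (selField V W s i x) (covC g x a V0) = 0 := by
  have hi := (h.smooth_selField s i).cDiffAt hU hx
  have h0 := h.smooth_V0.cDiffAt hU hx
  have h2 := formC_covC_eq_zero hφ hi h0 (c := 0) (by
    filter_upwards [h.eventually_g_sel_kernel hU s i hx, hU.mem_nhds hx] with y hy hyU
    exact ((h.normal y hyU).phi_sel s i _).trans (by rw [← selField, hy, mul_zero])) hai ha0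
  have e1 := (h.normal x hx).phi_sel s i (covC g x a V0)
  rw [← selField] at e1
  rw [hτ, e1, φ.cForm_swap x (V0 x), (h.normal x hx).phi_kernel] at h2
  refine (mul_eq_zero.1 ?_).resolve_left ((h.normal x hx).sel_ne_zero hgen s i)
  linear_combination h2

theorem g_covC_sel (h : IsNormalFrameOn g φ U lam V0 V W) (hU : IsOpen U)
    (hφ : IsConformalKillingYano g φ) (s : Fin m → Bool) {x : M} (hx : x ∈ U)
    (hgen : IsGenericAt m g φ x) (hτ : TauConditionAt m g φ x) (k i j : Fin m) :
    g.cForm x (covC g x (selField V W s k x) (selField V W s i)) (selField V W s j x) = 0 :=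
  h.g_covC_sel_sel hU hφ s hx hgen i j ((h.normal x hx).g_sel_sel s k i)
    ((h.normal x hx).g_sel_sel s k j)
    (hτ.sel_eq_zero (h.normal x hx) (extDeriv_swap₁₂ hφ x) (extDeriv_swap₂₃ hφ x) s k i j)

theorem g_covC_kernel (h : IsNormalFrameOn g φ U lam V0 V W) (hU : IsOpen U)
    (hφ : IsConformalKillingYano g φ) (s : Fin m → Bool) {x : M} (hx : x ∈ U)
    (hgen : IsGenericAt m g φ x) (hτ : TauConditionAt m g φ x) (k i : Fin m) :
    g.cForm x (selField V W s i x) (covC g x (selField V W s k x) V0) = 0 :=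
  h.g_covC_sel_kernel hU hφ s hx hgen i ((h.normal x hx).g_sel_sel s k i)
    ((h.normal x hx).g_sel_kernel s k)
    (hτ.sel_kernel_eq_zero (h.normal x hx) (extDeriv_swap₁₂ hφ x) s k i)

theorem g_covC_kernel_direction (h : IsNormalFrameOn g φ U lam V0 V W) (hU : IsOpen U)
    (hφ : IsConformalKillingYano g φ) (s : Fin m → Bool) {x : M} (hx : x ∈ U)
    (hgen : IsGenericAt m g φ x) (hτ : TauConditionAt m g φ x) (i j : Fin m) :
    g.cForm x (covC g x (V0 x) (selField V W s i)) (selField V W s j x) = 0 := by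
  have h0 (k : Fin m) : g.cForm x (V0 x) (selField V W s k x) = 0 :=
    (h.normal x hx).g_kernel_sel s k
  refine h.g_covC_sel_sel hU hφ s hx hgen i j (h0 i) (h0 j) ?_
  have h1 : extDerivC φ x (selField V W s i x) (selField V W s j x) (V0 x) = 0 :=
    hτ.sel_kernel_eq_zero (h.normal x hx) (extDeriv_swap₁₂ hφ x) s i j
  rw [extDerivC, cExt₃_swap₁₂ (extDeriv_swap₁₂ hφ x), cExt₃_swap₂₃ (extDeriv_swap₂₃ hφ x), neg_neg]
  exact h1

/-- The bracket has to be orthogonal to every `X_k` and to `V_0`. In both cases each of the two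
terms of the antisymmetrised second fundamental form vanishes on the frame. -/
theorem isIntegrableOn_choiceDist (h : IsNormalFrameOn g φ U lam V0 V W)
    (hφ : IsConformalKillingYano g φ) (hgen : ∀ x, IsGenericAt m g φ x)
    (hτ : ∀ x, TauConditionAt m g φ x) (hU : IsOpen U) (s : Fin m → Bool) :
    IsIntegrableOn (choiceDist V W s) U := by
  intro U' hU'U hU' A B hA hB hAD hBD x hx
  have hxU := hU'U hx
  have hnull {C : Π x : M, CTangent (2 * m + 1) x} (hC : ∀ x ∈ U', C x ∈ choiceDist V W s x)
      (k : Fin m) : ∀ᶠ y in 𝓝 x, g.cForm y (C y) (selField V W s k y) = 0 := by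
    filter_upwards [hU'.mem_nhds hx] with y hy
    exact ((h.normal y (hU'U hy)).isMaximalIsotropic_span_sel (hgen y) s).2.1 _ (hC y hy) _
      (Submodule.subset_span ⟨k, rfl⟩)
  have hnull0 {C : Π x : M, CTangent (2 * m + 1) x} (hC : ∀ x ∈ U', C x ∈ choiceDist V W s x) :
      ∀ᶠ y in 𝓝 x, g.cForm y (C y) (V0 y) = 0 := by
    filter_upwards [hU'.mem_nhds hx] with y hy
    refine (Submodule.span_le (p := LinearMap.ker ((g.cForm y).flip (V0 y)))).2 ?_ (hC y hy)
    rintro _ ⟨i, rfl⟩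
    exact (h.normal y (hU'U hy)).g_sel_kernel s i
  refine (h.normal x hxU).mem_span_sel s (fun k ↦ ?_) ?_
  · refine gC_lieBracketC_eq_zero g (hA.cDiffAt hU' hx) (hB.cDiffAt hU' hx)
      ((h.smooth_selField s k).cDiffAt hU hxU) (hnull hAD k) (hnull hBD k) (hAD x hx) (hBD x hx) ?_
    rintro _ ⟨i, rfl⟩ _ ⟨j, rfl⟩
    rw [g.cForm_symm, g.cForm_symm x _ (covC g x _ _)]
    exact (h.g_covC_sel hU hφ s hxU (hgen x) (hτ x) j k i).trans
      (h.g_covC_sel hU hφ s hxU (hgen x) (hτ x) i k j).symm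
  · refine gC_lieBracketC_eq_zero g (hA.cDiffAt hU' hx) (hB.cDiffAt hU' hx)
      (h.smooth_V0.cDiffAt hU hxU) (hnull0 hAD) (hnull0 hBD) (hAD x hx) (hBD x hx) ?_
    rintro _ ⟨i, rfl⟩ _ ⟨j, rfl⟩
    exact (h.g_covC_kernel hU hφ s hxU (hgen x) (hτ x) j i).trans
      (h.g_covC_kernel hU hφ s hxU (hgen x) (hτ x) i j).symm

/-- Only orthogonality to the `X_k` is needed, but `V_0` is now also a generator, so derivatives of
`X_k` along `V_0` enter. Nothing is needed about `∇_{V_0} V_0` or `∇_{V_0} X_k` in the `V_0`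
direction, as the pair `(V_0, V_0)` cancels by antisymmetry. -/
theorem isIntegrableOn_choiceDistAdjoin (h : IsNormalFrameOn g φ U lam V0 V W)
    (hφ : IsConformalKillingYano g φ) (hgen : ∀ x, IsGenericAt m g φ x)
    (hτ : ∀ x, TauConditionAt m g φ x) (hU : IsOpen U) (s : Fin m → Bool) :
    IsIntegrableOn (choiceDistAdjoin V0 V W s) U := by
  intro U' hU'U hU' A B hA hB hAD hBD x hx
  have hxU := hU'U hx
  have hnull {C : Π x : M, CTangent (2 * m + 1) x}
      (hC : ∀ x ∈ U', C x ∈ choiceDistAdjoin V0 V W s x)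
      (k : Fin m) : ∀ᶠ y in 𝓝 x, g.cForm y (C y) (selField V W s k y) = 0 := by
    filter_upwards [hU'.mem_nhds hx] with y hy
    refine sup_le (c := LinearMap.ker ((g.cForm y).flip (selField V W s k y)))
      (Submodule.span_le.2 ?_) (Submodule.span_le.2 ?_) (hC y hy)
    · rintro _ ⟨i, rfl⟩
      exact (h.normal y (hU'U hy)).g_sel_sel s i k
    · rintro _ rfl
      exact (h.normal y (hU'U hy)).g_kernel_sel s k
  have hspan : choiceDistAdjoin V0 V W s x =
      Submodule.span ℂ (Set.range (fun i ↦ selField V W s i x) ∪ {V0 x}) :=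
    Submodule.span_union _ _ |>.symm
  refine (h.normal x hxU).mem_span_sel_sup s fun k ↦ ?_
  refine gC_lieBracketC_eq_zero g (hA.cDiffAt hU' hx) (hB.cDiffAt hU' hx)
    ((h.smooth_selField s k).cDiffAt hU hxU) (hnull hAD k) (hnull hBD k)
    (hspan ▸ hAD x hx) (hspan ▸ hBD x hx) ?_
  -- Since `g(X_k, V_0) = 0`, this product is minus `g(X_k, ∇_{X_i} V_0)`, which is known to vanish.
  have hX0 (i : Fin m) :
      g.cForm x (V0 x) (covC g x (selField V W s i x) (selField V W s k)) = 0 := by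
    have h1 := gC_covC_eq_zero g ((h.smooth_selField s k).cDiffAt hU hxU)
      (h.smooth_V0.cDiffAt hU hxU) (h.eventually_g_sel_kernel hU s k hxU) (selField V W s i x)
    rwa [h.g_covC_kernel hU hφ s hxU (hgen x) (hτ x), add_zero, g.cForm_symm] at h1
  have h0X (i : Fin m) :
      g.cForm x (selField V W s i x) (covC g x (V0 x) (selField V W s k)) = 0 := by
    rw [g.cForm_symm]
    exact h.g_covC_kernel_direction hU hφ s hxU (hgen x) (hτ x) k i
  rintro a (⟨i, rfl⟩ | rfl) b (⟨j, rfl⟩ | rfl)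
  · rw [g.cForm_symm, g.cForm_symm x _ (covC g x _ _)]
    exact (h.g_covC_sel hU hφ s hxU (hgen x) (hτ x) j k i).trans
      (h.g_covC_sel hU hφ s hxU (hgen x) (hτ x) i k j).symm
  · exact (h0X i).trans (hX0 i).symm
  · exact (hX0 j).trans (h0X j).symm
  · rfl

theorem isSubbundleOn_choiceDist (h : IsNormalFrameOn g φ U lam V0 V W) (hU : IsOpen U)
    (s : Fin m → Bool) : IsSubbundleOn m (choiceDist V W s) U := fun _ hx ↦
  ⟨U, subset_rfl, hU, hx, selField V W s, h.smooth_selField s,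
    fun y hy ↦ ⟨(h.normal y hy).linearIndependent_sel s, rfl⟩⟩

theorem isSubbundleOn_choiceDistAdjoin (h : IsNormalFrameOn g φ U lam V0 V W) (hU : IsOpen U)
    (s : Fin m → Bool) : IsSubbundleOn (m + 1) (choiceDistAdjoin V0 V W s) U := by
  refine fun x hx ↦ ⟨U, subset_rfl, hU, hx, Fin.cons V0 (selField V W s), fun i ↦ ?_,
    fun y hy ↦ ?_⟩
  · refine Fin.cases ?_ (fun i ↦ ?_) i
    · exact h.smooth_V0
    · exact h.smooth_selField s i
  · have e : (fun i ↦ (Fin.cons V0 (selField V W s) : Fin (m + 1) → Π x : M, _) i y) =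
        Fin.cons (V0 y) fun i ↦ selField V W s i y := by
      funext i
      refine Fin.cases ?_ (fun i ↦ ?_) i <;> simp
    rw [e]
    refine ⟨(h.normal y hy).linearIndependent_cons_sel s, ?_⟩
    rw [Fin.range_cons, Submodule.span_insert, sup_comm]
    rfl

theorem isCRStructureOn (h : IsNormalFrameOn g φ U lam V0 V W)
    (hφ : IsConformalKillingYano g φ) (hgen : ∀ x, IsGenericAt m g φ x)
    (hτ : ∀ x, TauConditionAt m g φ x) (hU : IsOpen U) (s : Fin m → Bool)
    (hs : ∀ x ∈ U, choiceDist V W s x ⊓ conjSubspace (choiceDist V W s x) = ⊥) :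
    IsCRStructureOn m (choiceDist V W s) U where
  subbundle := h.isSubbundleOn_choiceDist hU s
  inf_conj := hs
  integrable := h.isIntegrableOn_choiceDist hφ hgen hτ hU s

end IsNormalFrameOn

end CKY

/-! ### Perturbation of simple eigenvectors, and pairing of eigenvalues -/

namespace CKY

open Filter Topology

/-- Smooth dependence of a simple generalised eigenvalue and its eigenvector on the two
operators. -/
theorem exists_analytic_eigenpair {E : Type*} [NormedAddCommGroup E] [NormedSpace ℂ E]
    [FiniteDimensional ℂ E] {P G : E →L[ℂ] E} {c : ℂ} {v : E} (hv : v ≠ 0)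
    (h : P v = c • G v)
    (hinj : ∀ (v' : E) (c' : ℂ), P v' - c • G v' = c' • G v → c' = 0 ∧ ∃ t : ℂ, v' = t • v) :
    ∃ f : (E →L[ℂ] E) × (E →L[ℂ] E) → ℂ × E, f (P, G) = (c, v) ∧ ContDiffAt ℂ ω f (P, G) ∧
      ∀ᶠ p in 𝓝 (P, G), p.1 (f p).2 = (f p).1 • p.2 (f p).2 := by
  have : CompleteSpace E := FiniteDimensional.complete ℂ E
  -- The normalisation `l v = 1` removes the freedom of rescaling the eigenvector, so that
  -- eigenpairs become isolated zeros.
  obtain ⟨l, hl⟩ := SeparatingDual.exists_eq_one (R := ℂ) hv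
  let F : ((E →L[ℂ] E) × (E →L[ℂ] E)) × (ℂ × E) → E × ℂ :=
    fun p ↦ (p.1.1 p.2.2 - p.2.1 • p.1.2 p.2.2, l p.2.2)
  have hF : ContDiff ℂ ω F := by fun_prop
  -- The partial derivative of `F` in `(c, v)`, namely `(c', v') ↦ (P v' - c G v' - c' G v, l v')`.
  let L : ℂ × E →L[ℂ] E × ℂ :=
    ((P ∘L .snd ℂ ℂ E) -
      (c • (G ∘L .snd ℂ ℂ E) + (ContinuousLinearMap.fst ℂ ℂ E).smulRight (G v))).prod
      (l ∘L .snd ℂ ℂ E)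
  have hL : fderiv ℂ F ((P, G), (c, v)) ∘L .inr ℂ _ _ = L := by
    have h1 : HasFDerivAt (fun q : ℂ × E ↦ F ((P, G), q))
        (fderiv ℂ F ((P, G), (c, v)) ∘L .inr ℂ _ _) (c, v) :=
      ((hF.contDiffAt.differentiableAt (by simp)).hasFDerivAt).comp (c, v)
        (hasFDerivAt_prodMk_right (P, G) (c, v))
    have h2 : HasFDerivAt (fun q : ℂ × E ↦ F ((P, G), q)) L (c, v) := by
      refine HasFDerivAt.prodMk (HasFDerivAt.sub ?_ ?_) ?_
      · exact (P ∘L .snd ℂ ℂ E).hasFDerivAt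
      · exact HasFDerivAt.fun_smul (c := Prod.fst) (f := fun q : ℂ × E ↦ G q.2) (x := (c, v))
          hasFDerivAt_fst (G ∘L .snd ℂ ℂ E).hasFDerivAt
      · exact (l ∘L .snd ℂ ℂ E).hasFDerivAt
    exact h1.unique h2
  have hLinj : Function.Injective L := by
    rw [injective_iff_map_eq_zero]
    rintro ⟨c', v'⟩ h0
    simp only [L, ContinuousLinearMap.prod_apply, Prod.mk_eq_zero] at h0
    obtain ⟨h1, h2⟩ := h0
    simp at h1 h2
    -- Simplicity leaves only `c' = 0` and `v' = t v`, and the normalisation then forces `t = 0`.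
    -- Equal dimensions make the injective derivative invertible.
    obtain ⟨rfl, t, rfl⟩ := hinj v' c' (by rw [← sub_eq_zero, ← h1]; abel)
    simp [hl] at h2
    simp [h2]
  have hinv : (fderiv ℂ F ((P, G), (c, v)) ∘L .inr ℂ _ _).IsInvertible := by
    rw [hL]
    refine ⟨(LinearMap.linearEquivOfInjective (L : ℂ × E →ₗ[ℂ] E × ℂ) hLinj
      (by simp [add_comm])).toContinuousLinearEquiv, ?_⟩
    ext <;> rfl
  have hω : (ω : WithTop ℕ∞) ≠ 0 := by simp
  refine ⟨hF.contDiffAt.implicitFunction hω hinv, ?_, ?_, ?_⟩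
  · exact hF.contDiffAt.implicitFunction_apply_self hω hinv
  · exact hF.contDiffAt.contDiffAt_implicitFunction hω hinv
  · filter_upwards [hF.contDiffAt.eventually_apply_implicitFunction hω hinv] with p hp
    have := congrArg Prod.fst hp
    simp only [F] at this
    rw [h, sub_self, sub_eq_zero] at this
    exact this

/-- A finite set of non-zero complex numbers stable under negation splits into pairs. -/
theorem exists_enumeration_neg {S : Set ℂ} {m : ℕ} (hS : S.ncard = 2 * m) (hfin : S.Finite)
    (h0 : (0 : ℂ) ∉ S) (hneg : ∀ c ∈ S, -c ∈ S) :
    ∃ lam : Fin m → ℂ, Function.Injective (Sum.elim lam (-lam)) ∧ ∀ i, lam i ∈ S := by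
  -- A half-plane with half of its boundary line: it contains exactly one of `c` and `-c` for each
  -- `c ≠ 0` and so selects one eigenvalue from each pair.
  let H : Set ℂ := {c | 0 < c.re ∨ (c.re = 0 ∧ 0 < c.im)}
  have hH {c : ℂ} (hc : c ∈ H) : -c ∉ H := by
    rintro (h | h) <;> rcases hc with h' | h' <;> simp at h <;> linarith
  have hH' {c : ℂ} (hc : c ≠ 0) (hcH : c ∉ H) : -c ∈ H := by
    simp only [H, Set.mem_ofPred_eq, not_or, not_and, not_lt, Complex.neg_re, Complex.neg_im,
      Left.neg_pos_iff, neg_eq_zero] at hcH ⊢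
    rcases lt_or_eq_of_le hcH.1 with h | h
    · exact .inl h
    · refine .inr ⟨h, lt_of_le_of_ne (hcH.2 h) fun hi ↦ hc (Complex.ext h hi)⟩
  have hunion : S = S ∩ H ∪ (fun c ↦ -c) '' (S ∩ H) := by
    ext c
    constructor
    · intro hc
      by_cases hcH : c ∈ H
      · exact .inl ⟨hc, hcH⟩
      · exact .inr ⟨-c, ⟨hneg c hc, hH' (fun h ↦ h0 (h ▸ hc)) hcH⟩, neg_neg c⟩
    · rintro (hc | ⟨d, hd, rfl⟩)
      · exact hc.1
      · exact hneg d hd.1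
  have hdisj : Disjoint (S ∩ H) ((fun c ↦ -c) '' (S ∩ H)) := by
    rw [Set.disjoint_left]
    rintro _ hc ⟨d, hd, rfl⟩
    exact hH hd.2 hc.2
  have hfin' : (S ∩ H).Finite := hfin.inter_of_left _
  have hcard : (S ∩ H).ncard = m := by
    have := Set.ncard_union_eq hdisj hfin' (hfin'.image _)
    rw [← hunion, hS, Set.ncard_image_of_injective _ neg_injective] at this
    omega
  have : Finite (S ∩ H : Set ℂ) := hfin'
  let e : (S ∩ H : Set ℂ) ≃ Fin m := Finite.equivFinOfCardEq hcard
  refine ⟨fun i ↦ (e.symm i : ℂ), ?_, fun i ↦ (e.symm i).2.1⟩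
  have hi : Function.Injective fun i ↦ (e.symm i : ℂ) :=
    Subtype.val_injective.comp e.symm.injective
  rintro (i | i) (j | j) hij
  · rw [hi hij]
  · exact absurd ((e.symm i).2.2) (by
      rw [show (e.symm i : ℂ) = -(e.symm j : ℂ) from hij]
      exact hH (e.symm j).2.2)
  · exact absurd ((e.symm j).2.2) (by
      rw [show (e.symm j : ℂ) = -(e.symm i : ℂ) from (show -(e.symm i : ℂ) = e.symm j from hij).symm]
      exact hH (e.symm i).2.2)
  · rw [hi (neg_injective hij)]

section Pointwise

variable {n : ℕ} {M : Type*} [TopologicalSpace M] [ChartedSpace (EuclideanSpace ℝ (Fin n)) M]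
  [IsManifold (𝓡 n) ∞ M]

theorem raise_apply_eq_smul_iff (g : PseudoRiemannianMetric n M) (φ : TwoForm n M) {x : M}
    {c : ℂ} {z : CTangent n x} : (raise g φ x).baseChange ℂ z = c • z ↔
      ∀ w, φ.cForm x z w = c * g.cForm x z w := by
  constructor
  · intro h w
    rw [← cForm_baseChange_raise g, h, map_smul]
    rfl
  · intro h
    rw [← sub_eq_zero]
    refine g.cForm_nondegenerate fun w ↦ ?_
    rw [map_sub, LinearMap.sub_apply, cForm_baseChange_raise, h, map_smul]
    exact sub_self _

/-- By skewness an eigenvector `z` for `c` is orthogonal to the image of `φ^♯ + c`. If `-c` were not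
an eigenvalue, that image would be everything and `z` would vanish. -/
theorem hasEigenvalue_neg (g : PseudoRiemannianMetric n M) (φ : TwoForm n M) {x : M} {c : ℂ}
    (h : Module.End.HasEigenvalue ((raise g φ x).baseChange ℂ) c) :
    Module.End.HasEigenvalue ((raise g φ x).baseChange ℂ) (-c) := by
  obtain ⟨z, hz⟩ := h.exists_hasEigenvector
  by_contra hcon
  rw [Module.End.hasEigenvalue_iff, not_not, Module.End.eigenspace_def] at hcon
  have hsurj := LinearMap.surjective_of_injective (LinearMap.ker_eq_bot.1 hcon)
  refine hz.2 (g.cForm_nondegenerate fun w ↦ ?_)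
  obtain ⟨y, rfl⟩ := hsurj w
  have h1 := (raise_apply_eq_smul_iff g φ).1 hz.apply_eq_smul y
  have h2 := cForm_baseChange_raise g φ x y z
  rw [φ.cForm_swap x z y, h1, g.cForm_symm] at h2
  simp only [LinearMap.sub_apply, map_sub, h2, LinearMap.smul_apply, Module.End.one_apply,
    map_smul, smul_eq_mul]
  ring

end Pointwise

/-! ### Eigenvectors at a point and their products -/

section Eigenframe

variable {m : ℕ} {M : Type*} [TopologicalSpace M]
  [ChartedSpace (EuclideanSpace ℝ (Fin (2 * m + 1))) M] [IsManifold (𝓡 (2 * m + 1)) ∞ M]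
  {g : PseudoRiemannianMetric (2 * m + 1) M} {φ : TwoForm (2 * m + 1) M} {x : M}

/-- The `2m` non-zero eigenvalues split into opposite pairs, and the kernel supplies the eigenvalue
`0`. Together these are `2m + 1` distinct eigenvalues, as many as the dimension. -/
theorem exists_eigenvectors (hgen : IsGenericAt m g φ x) :
    ∃ (c : NIdx m → ℂ) (z : NIdx m → CTangent (2 * m + 1) x), Function.Injective c ∧
      (∀ a, c a.flip = -c a) ∧ (∀ a, z a ≠ 0) ∧
      ∀ a w, φ.cForm x (z a) w = c a * g.cForm x (z a) w := by
  set f := (raise g φ x).baseChange ℂ with hf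
  obtain ⟨lam, hinj, hlam⟩ := exists_enumeration_neg hgen.1
    (Set.Finite.subset (Module.End.finite_hasEigenvalue f) fun c hc ↦ hc.2) (fun h ↦ h.1 rfl)
    fun c hc ↦ ⟨neg_ne_zero.2 hc.1, hasEigenvalue_neg g φ hc.2⟩
  have hev (a : NIdx m) : ∃ z : CTangent (2 * m + 1) x, f z = nFam 0 lam (-lam) a • z ∧ z ≠ 0 := by
    rcases a with _ | i | i
    · obtain ⟨⟨k, hk⟩, hk0⟩ := Module.finrank_pos_iff_exists_ne_zero.1
        (by rw [hgen.2]; exact one_pos : 0 < Module.finrank ℝ (LinearMap.ker (raise g φ x)))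
      refine ⟨1 ⊗ₜ[ℝ] k, ?_, fun h0 ↦ hk0 ?_⟩
      · rw [hf, LinearMap.baseChange_tmul, LinearMap.mem_ker.1 hk, TensorProduct.tmul_zero]
        simp [nFam]
      · have := congrArg rePart h0
        simpa [rePart] using this
    · obtain ⟨z, hz⟩ := (hlam i).2.exists_hasEigenvector
      exact ⟨z, hz.apply_eq_smul, hz.2⟩
    · obtain ⟨z, hz⟩ := (hasEigenvalue_neg g φ (hlam i).2).exists_hasEigenvector
      exact ⟨z, hz.apply_eq_smul, hz.2⟩
  choose z hz hz0 using hev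
  refine ⟨nFam 0 lam (-lam), z, ?_, ?_, hz0, fun a ↦ (raise_apply_eq_smul_iff g φ).1 (hz a)⟩
  · have hne (a : Fin m ⊕ Fin m) : Sum.elim lam (-lam) a ≠ 0 := by
      rcases a with i | i
      · exact (hlam i).1
      · exact neg_ne_zero.2 (hlam i).1
    rintro (_ | a) (_ | b) hab
    · rfl
    · exact absurd hab.symm (hne b)
    · exact absurd hab (hne a)
    · rw [hinj hab]
  · rintro (_ | i | i) <;> simp [nFam, NIdx.flip]

/-- Evaluating `φ(z_a, z_b)` from either side shows, by antisymmetry of `φ`, that only eigenvectors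
with opposite eigenvalues can have a non-zero product. -/
theorem g_eq_zero_of_eigen {c : NIdx m → ℂ} {z : NIdx m → CTangent (2 * m + 1) x}
    (hz : ∀ a w, φ.cForm x (z a) w = c a * g.cForm x (z a) w) (a b : NIdx m) :
    (c a + c b) * g.cForm x (z a) (z b) = 0 := by
  have h1 := hz a (z b)
  rw [φ.cForm_swap x (z b), hz b, g.cForm_symm x (z b)] at h1
  linear_combination -h1

theorem add_ne_zero_of_injective {c : NIdx m → ℂ} (hc : Function.Injective c)
    (hflip : ∀ a, c a.flip = -c a) {a b : NIdx m} (hab : b ≠ a.flip) : c a + c b ≠ 0 := by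
  intro h
  refine hab (hc ?_)
  rw [hflip]
  linear_combination h

theorem eq_zero_of_eigen {c : NIdx m → ℂ} {z : NIdx m → CTangent (2 * m + 1) x}
    (hz : ∀ a w, φ.cForm x (z a) w = c a * g.cForm x (z a) w) (hc : Function.Injective c)
    (hz0 : ∀ a, z a ≠ 0) {y : CTangent (2 * m + 1) x} (hy : ∀ a, g.cForm x y (z a) = 0) :
    y = 0 := by
  have hli : LinearIndependent ℂ z :=
    Module.End.eigenvectors_linearIndependent' ((raise g φ x).baseChange ℂ) c hc z fun a ↦
      ⟨Module.End.mem_eigenspace_iff.2 ((raise_apply_eq_smul_iff g φ).2 (hz a)), hz0 a⟩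
  let B := basisOfLinearIndependentOfCardEqFinrank hli (by rw [finrank_cTangent]; simp; ring)
  refine g.cForm_nondegenerate fun w ↦ ?_
  have : g.cForm x y = 0 := B.ext fun a ↦ by simp [B, hy]
  rw [this]
  rfl

/-- Each `z_a` is orthogonal to all the other members of the eigenbasis, so nondegeneracy of `g`
forces a non-zero product with its partner. -/
theorem g_flip_ne_zero {c : NIdx m → ℂ} {z : NIdx m → CTangent (2 * m + 1) x}
    (hz : ∀ a w, φ.cForm x (z a) w = c a * g.cForm x (z a) w) (hc : Function.Injective c)
    (hflip : ∀ a, c a.flip = -c a) (hz0 : ∀ a, z a ≠ 0) (a : NIdx m) :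
    g.cForm x (z a) (z a.flip) ≠ 0 := by
  intro h
  refine hz0 a (eq_zero_of_eigen hz hc hz0 fun b ↦ ?_)
  by_cases hb : b = a.flip
  · rw [hb, h]
  · exact (mul_eq_zero.1 (g_eq_zero_of_eigen hz a b)).resolve_left
      (add_ne_zero_of_injective hc hflip hb)

/-- The simplicity required by the implicit function theorem. Pairing with the partner of `z_a`
kills the left-hand side and gives `c' = 0`, so there is no generalised eigenvector. Pairing with
the remaining eigenvectors shows that the eigenspace is a line. -/
theorem eigen_simple {c : NIdx m → ℂ} {z : NIdx m → CTangent (2 * m + 1) x}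
    (hz : ∀ a w, φ.cForm x (z a) w = c a * g.cForm x (z a) w) (hc : Function.Injective c)
    (hflip : ∀ a, c a.flip = -c a) (hz0 : ∀ a, z a ≠ 0) {a : NIdx m} {c' : ℂ}
    {y : CTangent (2 * m + 1) x}
    (hy : ∀ w, φ.cForm x y w - c a * g.cForm x y w = c' * g.cForm x (z a) w) :
    c' = 0 ∧ ∃ t : ℂ, y = t • z a := by
  have hne := g_flip_ne_zero hz hc hflip hz0 a
  have hyb (b : NIdx m) : -(c b + c a) * g.cForm x y (z b) = c' * g.cForm x (z a) (z b) := by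
    have h1 := hy (z b)
    rw [φ.cForm_swap x (z b) y, hz b, g.cForm_symm x (z b)] at h1
    linear_combination h1
  have hc' : c' = 0 := by
    have h1 := hyb a.flip
    rw [hflip, neg_add_cancel, neg_zero, zero_mul] at h1
    exact (mul_eq_zero.1 h1.symm).resolve_right hne
  subst hc'
  refine ⟨rfl, g.cForm x y (z a.flip) / g.cForm x (z a) (z a.flip), ?_⟩
  rw [← sub_eq_zero]
  refine eq_zero_of_eigen hz hc hz0 fun b ↦ ?_
  rw [map_sub, LinearMap.sub_apply, map_smul, LinearMap.smul_apply, smul_eq_mul]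
  by_cases hb : b = a.flip
  · subst hb
    rw [div_mul_cancel₀ _ hne, sub_self]
  · have hab := add_ne_zero_of_injective hc hflip hb
    rw [(mul_eq_zero.1 (g_eq_zero_of_eigen hz a b)).resolve_left hab]
    have h1 := hyb b
    rw [zero_mul] at h1
    rw [(mul_eq_zero.1 h1).resolve_left (neg_ne_zero.2 (by rwa [add_comm]))]
    simp

/-- Rescaled eigenvectors form a normal form basis. -/
theorem isNormalBasisAt_of_eigen {c : NIdx m → ℂ} {z : NIdx m → CTangent (2 * m + 1) x}
    (hz : ∀ a w, φ.cForm x (z a) w = c a * g.cForm x (z a) w)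
    (hc : ∀ a b, b ≠ NIdx.flip a → c a + c b ≠ 0)
    (hne : ∀ a, g.cForm x (z a) (z (NIdx.flip a)) ≠ 0) {r : ℂ}
    (hr : r ^ 2 * g.cForm x (z none) (z none) = 1) :
    IsNormalBasisAt g φ x (fun i ↦ c (some (.inl i))) (r • z none) (fun i ↦ z (some (.inl i)))
      (fun i ↦ (g.cForm x (z (some (.inl i))) (z (some (.inr i))))⁻¹ • z (some (.inr i))) := by
  have h0 {a b : NIdx m} (hab : b ≠ a.flip) : g.cForm x (z a) (z b) = 0 :=
    (mul_eq_zero.1 (g_eq_zero_of_eigen hz a b)).resolve_left (hc a b hab)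
  have hvv (i j : Fin m) : g.cForm x (z (some (.inl i))) (z (some (.inl j))) = 0 :=
    h0 (by simp [NIdx.flip])
  have hww (i j : Fin m) : g.cForm x (z (some (.inr i))) (z (some (.inr j))) = 0 :=
    h0 (by simp [NIdx.flip])
  have hvw {i j : Fin m} (hij : i ≠ j) : g.cForm x (z (some (.inl i))) (z (some (.inr j))) = 0 :=
    h0 (by simpa [NIdx.flip] using Ne.symm hij)
  have hv0 (i : Fin m) : g.cForm x (z (some (.inl i))) (z none) = 0 := h0 (by simp [NIdx.flip])
  have hw0 (i : Fin m) : g.cForm x (z (some (.inr i))) (z none) = 0 := h0 (by simp [NIdx.flip])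
  have hii (i : Fin m) : g.cForm x (z (some (.inl i))) (z (some (.inr i))) ≠ 0 :=
    hne (some (.inl i))
  constructor
  case g_vw =>
    intro i j
    rw [gC_eq, map_smul]
    split
    · next h => subst h; exact inv_mul_cancel₀ (hii i)
    · next h => rw [hvw h, smul_zero]
  case phi_vw =>
    intro i j
    rw [formC_eq, map_smul, hz]
    split
    · next h =>
      subst h
      rw [smul_eq_mul, mul_left_comm, inv_mul_cancel₀ (hii i), mul_one]
    · next h => rw [hvw h, mul_zero, smul_zero]
  case g_00 =>
    rw [gC_eq, map_smul, map_smul, LinearMap.smul_apply, smul_smul, smul_eq_mul, ← hr]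
    ring
  all_goals
    intros
    simp only [gC_eq, formC_eq, map_smul, LinearMap.smul_apply, smul_eq_mul, hz, hvv, hww, hv0,
      hw0, mul_zero]

end Eigenframe

end CKY

/-! ### Smooth local frames and components -/

namespace CKY

open Filter Topology

section Frames

variable {n : ℕ} {M : Type*} [TopologicalSpace M] [ChartedSpace (EuclideanSpace ℝ (Fin n)) M]
  [IsManifold (𝓡 n) ∞ M]

/-- The real vector field `X` is smooth on `U`. -/
abbrev RealSmoothOn (X : Π x : M, TangentSpace (𝓡 n) x) (U : Set M) : Prop :=
  ContMDiffOn (𝓡 n) (𝓡 n).tangent ∞ (fun x ↦ (⟨x, X x⟩ : TangentBundle (𝓡 n) M)) U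

theorem exists_local_frame (x₀ : M) : ∃ N : Set M, IsOpen N ∧ x₀ ∈ N ∧
    ∃ e : Fin n → Π x : M, TangentSpace (𝓡 n) x, (∀ i, RealSmoothOn (e i) N) ∧
      ∀ x ∈ N, ∃ B : Module.Basis (Fin n) ℝ (TangentSpace (𝓡 n) x), ∀ i, B i = e i x := by
  let t := trivializationAt (EuclideanSpace ℝ (Fin n)) (TangentSpace (𝓡 n) : M → Type _) x₀
  let b := (EuclideanSpace.basisFun (Fin n) ℝ).toBasis
  refine ⟨t.baseSet, t.open_baseSet, FiberBundle.mem_baseSet_trivializationAt' x₀,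
    t.localFrame b, fun i ↦ ?_, fun x hx ↦ ⟨t.basisAt b hx, fun i ↦ ?_⟩⟩
  · exact t.contMDiffOn_localFrame_baseSet (I := 𝓡 n) ∞ b i
  · exact (t.localFrame_apply_of_mem_baseSet b hx).symm

theorem Tensor2.smoothOn (t : Tensor2 n M) {X Y : Π x : M, TangentSpace (𝓡 n) x} {U : Set M}
    (hX : RealSmoothOn X U) (hY : RealSmoothOn Y U) :
    ContMDiffOn (𝓡 n) 𝓘(ℝ, ℝ) ∞ (fun y ↦ t.form y (X y) (Y y)) U := by
  have h2 : ContMDiffOn (𝓡 n) ((𝓡 n).prod 𝓘(ℝ)) ∞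
      (fun m ↦ TotalSpace.mk' ℝ (E := Bundle.Trivial M ℝ) m (t.form m (X m) (Y m))) U :=
    ContMDiffOn.clm_bundle_apply₂ (F₁ := EuclideanSpace ℝ (Fin n))
      (F₂ := EuclideanSpace ℝ (Fin n)) t.smooth.contMDiffOn hX hY
  intro x hx
  exact ((Bundle.contMDiffWithinAt_totalSpace).1 (h2 x hx)).2

theorem Tensor2.smoothOn_cForm (t : Tensor2 n M) {A B : Π x : M, CTangent n x} {U : Set M}
    (hA : SmoothFieldOn A U) (hB : SmoothFieldOn B U) :
    ContMDiffOn (𝓡 n) 𝓘(ℝ, ℂ) ∞ (fun y ↦ t.cForm y (A y) (B y)) U := by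
  have h1 : ContDiff ℝ ∞ fun p : (ℝ × ℝ) × (ℝ × ℝ) ↦
      ((p.1.1 : ℂ) + Complex.I * p.1.2) + Complex.I * ((p.2.1 : ℂ) + Complex.I * p.2.2) := by
    have := Complex.ofRealCLM.contDiff (n := ∞)
    have e (f : (ℝ × ℝ) × (ℝ × ℝ) → ℝ) (hf : ContDiff ℝ ∞ f) :
        ContDiff ℝ ∞ fun p ↦ ((f p : ℝ) : ℂ) := this.comp hf
    have := e _ (contDiff_fst.comp contDiff_fst)
    have := e _ (contDiff_snd.comp contDiff_fst)
    have := e _ (contDiff_fst.comp contDiff_snd)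
    have := e _ (contDiff_snd.comp contDiff_snd)
    fun_prop
  exact h1.contMDiff.comp_contMDiffOn
    (((t.smoothOn hA.1 hB.1).prodMk_space (t.smoothOn hA.1 hB.2)).prodMk_space
      ((t.smoothOn hA.2 hB.1).prodMk_space (t.smoothOn hA.2 hB.2)))

theorem SmoothFieldOn.mono {A : Π x : M, CTangent n x} {U U' : Set M} (h : SmoothFieldOn A U)
    (hU : U' ⊆ U) : SmoothFieldOn A U' :=
  ⟨ContMDiffOn.mono h.1 hU, ContMDiffOn.mono h.2 hU⟩

theorem SmoothFieldOn.smul {f : M → ℂ} {A : Π x : M, CTangent n x} {U : Set M}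
    (hf : ContMDiffOn (𝓡 n) 𝓘(ℝ, ℂ) ∞ f U) (hA : SmoothFieldOn A U) :
    SmoothFieldOn (fun x ↦ f x • A x) U := by
  have hre : ContMDiffOn (𝓡 n) 𝓘(ℝ, ℝ) ∞ (fun x ↦ (f x).re) U :=
    Complex.reCLM.contDiff.contMDiff.comp_contMDiffOn hf
  have him : ContMDiffOn (𝓡 n) 𝓘(ℝ, ℝ) ∞ (fun x ↦ (f x).im) U :=
    Complex.imCLM.contDiff.contMDiff.comp_contMDiffOn hf
  constructor
  · simp only [rePart_smul]
    exact (hre.smul_section hA.1).sub_section (him.smul_section hA.2)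
  · simp only [imPart_smul]
    exact (hre.smul_section hA.2).add_section (him.smul_section hA.1)

/-- The complex vector with components `v` in the frame `e`. -/
noncomputable def cvec (e : Fin n → Π x : M, TangentSpace (𝓡 n) x) (v : Fin n → ℂ) (x : M) : CTangent n x :=
  ∑ i, v i • ((1 : ℂ) ⊗ₜ[ℝ] e i x)

theorem cvec_smul (e : Fin n → Π x : M, TangentSpace (𝓡 n) x) (c : ℂ) (v : Fin n → ℂ) (x : M) :
    cvec e (c • v) x = c • cvec e v x := by
  simp [cvec, Finset.smul_sum, mul_smul]

theorem cvec_eq {e : Fin n → Π x : M, TangentSpace (𝓡 n) x} {x : M}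
    {B : Module.Basis (Fin n) ℝ (TangentSpace (𝓡 n) x)} (hB : ∀ i, B i = e i x) (v : Fin n → ℂ) :
    cvec e v x = (Algebra.TensorProduct.basis ℂ B).equivFun.symm v := by
  simp [cvec, Module.Basis.equivFun_symm_apply, hB]

theorem smoothFieldOn_cvec {e : Fin n → Π x : M, TangentSpace (𝓡 n) x} {U : Set M}
    (he : ∀ i, RealSmoothOn (e i) U) {v : M → Fin n → ℂ}
    (hv : ContMDiffOn (𝓡 n) 𝓘(ℝ, Fin n → ℂ) ∞ v U) : SmoothFieldOn (fun x ↦ cvec e (v x) x) U := by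
  have hvi (i : Fin n) : ContMDiffOn (𝓡 n) 𝓘(ℝ, ℂ) ∞ (fun x ↦ v x i) U :=
    contMDiffOn_pi_space.1 hv i
  have hre (i : Fin n) : ContMDiffOn (𝓡 n) 𝓘(ℝ, ℝ) ∞ (fun x ↦ (v x i).re) U :=
    Complex.reCLM.contDiff.contMDiff.comp_contMDiffOn (hvi i)
  have him (i : Fin n) : ContMDiffOn (𝓡 n) 𝓘(ℝ, ℝ) ∞ (fun x ↦ (v x i).im) U :=
    Complex.imCLM.contDiff.contMDiff.comp_contMDiffOn (hvi i)
  constructor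
  · have e1 (x : M) : rePart (cvec e (v x) x) = ∑ i, (v x i).re • e i x := by
      simp [cvec, rePart, TensorProduct.smul_tmul']
    simp only [e1]
    exact ContMDiffOn.sum_section fun i _ ↦ (hre i).smul_section (he i)
  · have e1 (x : M) : imPart (cvec e (v x) x) = ∑ i, (v x i).im • e i x := by
      simp [cvec, imPart, TensorProduct.smul_tmul']
    simp only [e1]
    exact ContMDiffOn.sum_section fun i _ ↦ (him i).smul_section (he i)

/-- The matrix of a tensor in a frame, as a complex operator on component vectors. -/
noncomputable def Tensor2.op (t : Tensor2 n M) (e : Fin n → Π x : M, TangentSpace (𝓡 n) x) (x : M) :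
    (Fin n → ℂ) →L[ℂ] (Fin n → ℂ) :=
  ∑ i, ∑ j, t.form x (e i x) (e j x) •
    (ContinuousLinearMap.proj (R := ℂ) (φ := fun _ : Fin n ↦ ℂ) i).smulRight (Pi.single j (1 : ℂ))

theorem Tensor2.op_apply (t : Tensor2 n M) (e : Fin n → Π x : M, TangentSpace (𝓡 n) x) (x : M)
    (v : Fin n → ℂ) (k : Fin n) :
    t.op e x v k = t.cForm x (cvec e v x) ((1 : ℂ) ⊗ₜ[ℝ] e k x) := by
  have h (i : Fin n) : t.cForm x ((1 : ℂ) ⊗ₜ[ℝ] e i x) ((1 : ℂ) ⊗ₜ[ℝ] e k x) =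
      t.form x (e i x) (e k x) := cExt₂_one_tmul (t.bilin x) _ _
  simp only [Tensor2.op, cvec, map_sum, map_smul, LinearMap.sum_apply, LinearMap.smul_apply, h,
    _root_.sum_apply, Finset.sum_apply]
  refine Finset.sum_congr rfl fun i _ ↦ ?_
  rw [Finset.sum_eq_single k]
  · simp [mul_comm]
  · intro j _ hj
    simp [hj.symm]
  · simp

theorem Tensor2.smoothOn_op (t : Tensor2 n M) {e : Fin n → Π x : M, TangentSpace (𝓡 n) x}
    {U : Set M} (he : ∀ i, RealSmoothOn (e i) U) :
    ContMDiffOn (𝓡 n) 𝓘(ℝ, (Fin n → ℂ) →L[ℂ] (Fin n → ℂ)) ∞ (t.op e) U := by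
  unfold Tensor2.op
  refine contMDiffOn_finsetSum fun i _ ↦ contMDiffOn_finsetSum fun j _ ↦ ?_
  exact (t.smoothOn (he i) (he j)).smul contMDiffOn_const

/-- Translates relations in the pencil `φ - c g` into component vectors. Working with the pencil
rather than with `φ^♯` avoids inverting the matrix of `g`. -/
theorem op_eq_iff {φ g : Tensor2 n M} {e : Fin n → Π x : M, TangentSpace (𝓡 n) x} {x : M}
    {B : Module.Basis (Fin n) ℝ (TangentSpace (𝓡 n) x)} (hB : ∀ i, B i = e i x)
    {v v' : Fin n → ℂ} {c c' : ℂ} : φ.op e x v' - c • g.op e x v' = c' • g.op e x v ↔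
      ∀ w, φ.cForm x (cvec e v' x) w - c * g.cForm x (cvec e v' x) w =
        c' * g.cForm x (cvec e v x) w := by
  constructor
  · intro h w
    have : φ.cForm x (cvec e v' x) - c • g.cForm x (cvec e v' x) =
        c' • g.cForm x (cvec e v x) := by
      refine (Algebra.TensorProduct.basis ℂ B).ext fun k ↦ ?_
      have := congrFun h k
      simp only [Pi.sub_apply, Pi.smul_apply, Tensor2.op_apply] at this
      simpa [hB] using this
    exact congr($this w)
  · intro h
    funext k
    simpa only [Pi.sub_apply, Pi.smul_apply, Tensor2.op_apply, smul_eq_mul] using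
      h ((1 : ℂ) ⊗ₜ[ℝ] e k x)

end Frames

end CKY

/-! ### Existence of normal form frames -/

namespace CKY

open Filter Topology

section Existence

variable {m : ℕ} {M : Type*} [TopologicalSpace M]
  [ChartedSpace (EuclideanSpace ℝ (Fin (2 * m + 1))) M] [IsManifold (𝓡 (2 * m + 1)) ∞ M]
  {g : PseudoRiemannianMetric (2 * m + 1) M} {φ : TwoForm (2 * m + 1) M}

/-- The eigenvectors at a point extend to smooth eigenvector fields. -/
theorem exists_eigenfields {x₀ : M} {c : NIdx m → ℂ} {z : NIdx m → CTangent (2 * m + 1) x₀}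
    (hz : ∀ a w, φ.cForm x₀ (z a) w = c a * g.cForm x₀ (z a) w) (hc : Function.Injective c)
    (hflip : ∀ a, c a.flip = -c a) (hz0 : ∀ a, z a ≠ 0) :
    ∃ U : Set M, IsOpen U ∧ x₀ ∈ U ∧
      ∃ (C : NIdx m → M → ℂ) (Z : NIdx m → Π x : M, CTangent (2 * m + 1) x),
        (∀ a, ContMDiffOn (𝓡 (2 * m + 1)) 𝓘(ℝ, ℂ) ∞ (C a) U) ∧ (∀ a, SmoothFieldOn (Z a) U) ∧
        (∀ a, C a x₀ = c a) ∧ (∀ a, Z a x₀ = z a) ∧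
        ∀ x ∈ U, ∀ a w, φ.cForm x (Z a x) w = C a x * g.cForm x (Z a x) w := by
  obtain ⟨N, hN, hx₀, e, he, hB⟩ := exists_local_frame (n := 2 * m + 1) x₀
  obtain ⟨B₀, hB₀⟩ := hB x₀ hx₀
  let v (a : NIdx m) : Fin (2 * m + 1) → ℂ := (Algebra.TensorProduct.basis ℂ B₀).equivFun (z a)
  have hv (a : NIdx m) : cvec e (v a) x₀ = z a := by
    rw [cvec_eq hB₀]
    exact LinearEquiv.symm_apply_apply _ _
  have hv0 (a : NIdx m) : v a ≠ 0 := fun h ↦ hz0 a (by rw [← hv a, h]; simp [cvec])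
  have hpair (a : NIdx m) := exists_analytic_eigenpair (P := φ.op e x₀) (G := g.op e x₀)
    (c := c a) (hv0 a)
    (by
      -- With `v = 0` and `c' = 0` the pencil relation is the eigenvalue equation itself.
      have := (op_eq_iff (φ := φ.toTensor2) (g := g.toTensor2) hB₀ (v := 0) (v' := v a)
        (c := c a) (c' := 0)).2 fun w ↦ by rw [hv, hz, sub_self, zero_mul]
      rwa [zero_smul, sub_eq_zero] at this)
    (by
      intro v' c' h
      have h1 := (op_eq_iff hB₀).1 h
      rw [hv] at h1
      obtain ⟨h2, t, ht⟩ := eigen_simple hz hc hflip hz0 h1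
      refine ⟨h2, t, ?_⟩
      rw [← hv, ← cvec_smul, cvec_eq hB₀, cvec_eq hB₀] at ht
      exact LinearEquiv.injective _ ht)
  choose f hf0 hfs hfe using hpair
  let p (x : M) := (φ.op e x, g.op e x)
  have hp : ContMDiffOn (𝓡 (2 * m + 1)) 𝓘(ℝ, ((Fin (2 * m + 1) → ℂ) →L[ℂ] (Fin (2 * m + 1) → ℂ)) ×
      ((Fin (2 * m + 1) → ℂ) →L[ℂ] (Fin (2 * m + 1) → ℂ))) ∞ p N :=
    (φ.smoothOn_op he).prodMk_space (g.smoothOn_op he)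
  have hpc : ContinuousAt p x₀ := hp.continuousOn.continuousAt (hN.mem_nhds hx₀)
  have hgood : ∀ᶠ x in 𝓝 x₀, x ∈ N ∧ ∀ a, ContDiffAt ℂ ω (f a) (p x) ∧
      (p x).1 (f a (p x)).2 = (f a (p x)).1 • (p x).2 (f a (p x)).2 :=
    Eventually.and (hN.mem_nhds hx₀) (eventually_all.2 fun a ↦
      (hpc.eventually ((hfs a).eventually (by simp))).and (hpc.eventually (hfe a)))
  obtain ⟨U, hUsub, hU, hxU⟩ := mem_nhds_iff.1 hgood
  have hsm (a : NIdx m) : ContMDiffOn (𝓡 (2 * m + 1)) 𝓘(ℝ, ℂ × (Fin (2 * m + 1) → ℂ)) ∞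
      (fun x ↦ f a (p x)) U := by
    intro x hx
    -- The eigenpair is complex analytic in the two operators, hence real smooth; the operators are
    -- only real smooth in the point.
    have h1 : ContDiffAt ℝ ∞ (f a) (p x) :=
      (((hUsub hx).2 a).1.restrict_scalars ℝ).of_le le_top
    exact h1.contMDiffAt.comp_contMDiffWithinAt x ((hp x (hUsub hx).1).mono fun y hy ↦ (hUsub hy).1)
  refine ⟨U, hU, hxU, fun a x ↦ (f a (p x)).1, fun a x ↦ cvec e (f a (p x)).2 x, fun a ↦ ?_,
    fun a ↦ ?_, fun a ↦ ?_, fun a ↦ ?_, fun x hx a ↦ ?_⟩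
  · exact (contDiff_fst.contMDiff).comp_contMDiffOn (hsm a)
  · exact smoothFieldOn_cvec (fun i ↦ (he i).mono fun y hy ↦ (hUsub hy).1)
      ((contDiff_snd.contMDiff).comp_contMDiffOn (hsm a))
  · beta_reduce
    rw [show f a (p x₀) = (c a, v a) from hf0 a]
  · beta_reduce
    rw [show f a (p x₀) = (c a, v a) from hf0 a]
    exact hv a
  · obtain ⟨B, hB⟩ := hB x (hUsub hx).1
    have := (op_eq_iff (φ := φ.toTensor2) (g := g.toTensor2) hB (v := 0) (v' := (f a (p x)).2)
      (c := (f a (p x)).1) (c' := 0)).1 (by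
        rw [zero_smul, sub_eq_zero]
        exact ((hUsub hx).2 a).2)
    intro w
    have h2 := this w
    rwa [zero_mul, sub_eq_zero] at h2

/-- After shrinking the neighbourhood, the eigenvector fields have the same vanishing and
non-vanishing products as at `x₀`. Rescaling one vector of each pair, and the kernel vector by a
square root, gives the normal form. -/
theorem exists_isNormalFrameOn {x₀ : M} (hgen : IsGenericAt m g φ x₀) :
    ∃ U : Set M, IsOpen U ∧ x₀ ∈ U ∧
      ∃ (lam : Fin m → M → ℂ) (V0 : Π x : M, CTangent (2 * m + 1) x)
        (V W : Fin m → Π x : M, CTangent (2 * m + 1) x), IsNormalFrameOn g φ U lam V0 V W := by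
  obtain ⟨c, z, hc, hflip, hz0, hz⟩ := exists_eigenvectors hgen
  obtain ⟨U₁, hU₁, hx₁, C, Z, hC, hZ, hC0, hZ0, hCZ⟩ := exists_eigenfields hz hc hflip hz0
  let q (a : NIdx m) (x : M) : ℂ := g.cForm x (Z a x) (Z a.flip x)
  have hq (a : NIdx m) : ContMDiffOn (𝓡 (2 * m + 1)) 𝓘(ℝ, ℂ) ∞ (q a) U₁ :=
    g.smoothOn_cForm (hZ a) (hZ a.flip)
  have hq0 (a : NIdx m) : q a x₀ ≠ 0 := by
    simp only [q, hZ0]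
    exact g_flip_ne_zero hz hc hflip hz0 a
  have hqc (a : NIdx m) : ContinuousAt (q a) x₀ := (hq a).continuousOn.continuousAt
    (hU₁.mem_nhds hx₁)
  have hCc (a : NIdx m) : ContinuousAt (C a) x₀ := (hC a).continuousOn.continuousAt
    (hU₁.mem_nhds hx₁)
  -- Three open conditions that hold at `x₀`: non-opposite indices keep non-opposite eigenvalues,
  -- which gives orthogonality; the products of partners stay non-zero; and `q none x / q none x₀`
  -- stays near `1`, inside the domain of the logarithm.
  have hgood : ∀ᶠ x in 𝓝 x₀, x ∈ U₁ ∧ (∀ a b, b ≠ NIdx.flip a → C a x + C b x ≠ 0) ∧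
      (∀ a, q a x ≠ 0) ∧ q none x / q none x₀ ∈ Complex.slitPlane := by
    refine Eventually.and (hU₁.mem_nhds hx₁) (.and ?_ (.and ?_ ?_))
    · refine eventually_all.2 fun a ↦ eventually_all.2 fun b ↦ eventually_imp_distrib_left.2
        fun hab ↦ ((hCc a).add (hCc b)).eventually_ne ?_
      rw [Pi.add_apply, hC0, hC0]
      exact add_ne_zero_of_injective hc hflip hab
    · exact eventually_all.2 fun a ↦ (hqc a).eventually_ne (hq0 a)
    · refine ((hqc none).div_const _).eventually (Complex.isOpen_slitPlane.mem_nhds ?_)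
      beta_reduce
      rw [div_self (hq0 none)]
      exact Complex.one_mem_slitPlane
  obtain ⟨U, hUsub, hU, hxU⟩ := mem_nhds_iff.1 hgood
  have hUU₁ : U ⊆ U₁ := fun x hx ↦ (hUsub hx).1
  -- A smooth choice of `q none x ^ (-1/2)`: the constant `r₀` is a square root of `(q none x₀)⁻¹`,
  -- and the principal logarithm handles the ratio to the value at `x₀`.
  obtain ⟨r₀, hr₀⟩ := IsAlgClosed.exists_pow_nat_eq (q none x₀)⁻¹ (n := 2) two_pos
  let r (x : M) : ℂ := Complex.exp (-Complex.log (q none x / q none x₀) / 2) * r₀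
  have hr (x : M) (hx : x ∈ U) : r x ^ 2 * q none x = 1 := by
    have h1 : q none x / q none x₀ ≠ 0 := div_ne_zero ((hUsub hx).2.2.1 none) (hq0 none)
    simp only [r]
    rw [mul_pow, hr₀, ← Complex.exp_nat_mul]
    rw [show ((2 : ℕ) : ℂ) * (-Complex.log (q none x / q none x₀) / 2) =
      -Complex.log (q none x / q none x₀) by push_cast; ring, Complex.exp_neg, Complex.exp_log h1]
    have h2 := (hUsub hx).2.2.1 none
    have h3 := hq0 none
    field_simp
  have hrs : ContMDiffOn (𝓡 (2 * m + 1)) 𝓘(ℝ, ℂ) ∞ r U := by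
    intro x hx
    have h1 : ContDiffAt ℂ ∞ (fun t : ℂ ↦ Complex.exp (-Complex.log (t / q none x₀) / 2) * r₀)
        (q none x) := by
      have h2 : ContDiffAt ℂ ∞ (fun t : ℂ ↦ Complex.log (t / q none x₀)) (q none x) :=
        ContDiffAt.comp (q none x) (Complex.contDiffAt_log (hUsub hx).2.2.2)
          (contDiffAt_id.div_const _)
      fun_prop
    exact (h1.restrict_scalars ℝ).contMDiffAt.comp_contMDiffWithinAt x
      (((hq none) x (hUU₁ hx)).mono hUU₁)
  refine ⟨U, hU, hxU, fun i ↦ C (some (.inl i)), fun x ↦ r x • Z none x,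
    fun i ↦ Z (some (.inl i)), fun i x ↦ (q (some (.inl i)) x)⁻¹ • Z (some (.inr i)) x, ?_⟩
  refine ⟨.smul hrs ((hZ _).mono hUU₁), fun i ↦ (hZ _).mono hUU₁,
    fun i ↦ .smul (fun x hx ↦ ?_) ((hZ _).mono hUU₁), fun x hx ↦ ?_⟩
  · exact (contDiffAt_inv ℝ ((hUsub hx).2.2.1 _)).contMDiffAt.comp_contMDiffWithinAt x
      ((hq _ x (hUU₁ hx)).mono hUU₁)
  · exact isNormalBasisAt_of_eigen (hCZ x (hUU₁ hx)) (hUsub hx).2.1 (hUsub hx).2.2.1 (hr x hx)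

end Existence

end CKY

theorem mainTheorem2 {m : ℕ} (hm : 1 ≤ m) {M : Type*} [TopologicalSpace M] [T2Space M]
    [SecondCountableTopology M] [ChartedSpace (EuclideanSpace ℝ (Fin (2 * m + 1))) M]
    [IsManifold (𝓡 (2 * m + 1)) ∞ M]
    (g : CKY.PseudoRiemannianMetric (2 * m + 1) M) (φ : CKY.TwoForm (2 * m + 1) M)
    (hφ : CKY.IsConformalKillingYano g φ)
    (hgen : ∀ x, CKY.IsGenericAt m g φ x)
    (hτ : ∀ x, CKY.TauConditionAt m g φ x) :
    (∀ x₀ : M, ∃ U : Set M, IsOpen U ∧ x₀ ∈ U ∧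
      ∃ (lam : Fin m → M → ℂ) (V0 : Π x : M, CKY.CTangent (2 * m + 1) x)
        (V W : Fin m → Π x : M, CKY.CTangent (2 * m + 1) x),
        CKY.IsNormalFrameOn g φ U lam V0 V W) ∧
    ∀ (U : Set M) (lam : Fin m → M → ℂ) (V0 : Π x : M, CKY.CTangent (2 * m + 1) x)
      (V W : Fin m → Π x : M, CKY.CTangent (2 * m + 1) x),
      IsOpen U → CKY.IsNormalFrameOn g φ U lam V0 V W →
      (∀ x ∈ U, Function.Injective fun s : Fin m → Bool ↦ CKY.choiceDist V W s x) ∧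
      ∀ s : Fin m → Bool,
        (∀ x ∈ U, CKY.IsMaximalIsotropic m g φ x (CKY.choiceDist V W s x)) ∧
        CKY.IsSubbundleOn m (CKY.choiceDist V W s) U ∧
        CKY.IsIntegrableOn (CKY.choiceDist V W s) U ∧
        (g.IsRiemannian → CKY.IsCRStructureOn m (CKY.choiceDist V W s) U) ∧
        ((∀ x ∈ U, CKY.choiceDist V W s x ⊓ CKY.conjSubspace (CKY.choiceDist V W s x) = ⊥) →
          CKY.IsCRStructureOn m (CKY.choiceDist V W s) U) ∧
        CKY.IsSubbundleOn (m + 1) (CKY.choiceDistAdjoin V0 V W s) U ∧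
        CKY.IsIntegrableOn (CKY.choiceDistAdjoin V0 V W s) U := by
  refine ⟨fun x₀ ↦ CKY.exists_isNormalFrameOn (hgen x₀), fun U lam V0 V W hU h ↦
    ⟨fun x hx ↦ (h.normal x hx).span_sel_injective, fun s ↦ ?_⟩⟩
  have hiso (x) (hx : x ∈ U) : CKY.IsMaximalIsotropic m g φ x (CKY.choiceDist V W s x) :=
    (h.normal x hx).isMaximalIsotropic_span_sel (hgen x) s
  exact ⟨hiso, h.isSubbundleOn_choiceDist hU s, h.isIntegrableOn_choiceDist hφ hgen hτ hU s,
    fun hg ↦ h.isCRStructureOn hφ hgen hτ hU s fun x hx ↦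
      CKY.inf_conjSubspace_eq_bot hg (hiso x hx).2.1,
    h.isCRStructureOn hφ hgen hτ hU s, h.isSubbundleOn_choiceDistAdjoin hU s,
    h.isIntegrableOn_choiceDistAdjoin hφ hgen hτ hU s⟩
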